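/- **Setting.** Let $G$ be a probability distribution on $\mathbb{Z}_+=\{0,1,2,\dots\}$ with probability mass function $g$, mean $\mu_G$ and variance $\sigma_G^2$. For $\theta\in[0,1]$ the INAR(1) process is defined by $X_0=0$ and $$X_t=\sum_{j=1}^{X_{t-1}}Z_j^{(t)}+\varepsilon_t,\qquad t\ge 1,$$ where the $Z_j^{(t)}$ are i.i.d. Bernoulli variables with success probability $\theta$, independent of the i.i.d. innovations $\varepsilon_t$ with distribution $G$. Let $\mathbb{P}^{(n)}_{\theta}$ be the law of $(X_0,\dots,X_n)$ on $\mathbb{Z}_+^{n+1}$ (with its power set as $\sigma$-field). For $h\ge 0$ consider $\mathbb{P}^{(n)}_{1-h/n^2}$, where $1-h/n^2$ is replaced by $0$ for the finitely many $n$ with $n^2<h$. For probability measures $P,Q$, $dP/dQ$ denotes the density with respect to $Q$ of the part of $P$ that is absolutely continuous with respect to $Q$. **Theorem 3.1.** Assume that one of the following holds: 1. the support of $G$ is $\{0,\dots,M\}$ for some $M\in\mathbb{Z}_+$; 2. the support of $G$ is $\mathbb{Z}_+$, $\sigma_G^2<\infty$, and $g$ is eventually decreasing, i.e. there is $M$ with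 $g(k+1)\le g(k)$ for all $k\ge M$. Put $\mathbb{Q}_h=\mathrm{Poisson}(h\,g(0)\mu_G/2)$ on $\mathbb{Z}_+$ for $h\ge0$ (the Poisson distribution with mean $0$ being the point mass at $0$). Then the experiments $(\mathbb{P}^{(n)}_{1-h/n^2}\mid h\ge0)$ converge, as $n\to\infty$, to the experiment $(\mathbb{Q}_h\mid h\ge 0)$ in Le Cam's weak topology: for every finite $I\subset[0,\infty)$ and every $h_0\ge0$, $$\left(\frac{d\mathbb{P}^{(n)}_{1-h/n^2}}{d\mathbb{P}^{(n)}_{1-h_0/n^2}}(X_0,\dots,X_n)\right)_{h\in I}\xrightarrow{d}\left(\frac{d\mathbb{Q}_h}{d\mathbb{Q}_{h_0}}(Z)\right)_{h\in I}\quad\text{under }\mathbb{P}^{(n)}_{1-h_0/n^2},\qquad Z\sim\mathbb{Q}_{h_0}.$$ More precisely, for $h\ge0$ and $h_0>0$ we have, under $\mathbb{P}^{(n)}_{1-h_0/n^2}$ and with $Z\sim\mathbb{Q}_{h_0}$, $$\frac{d\mathbb{P}^{(n)}_{1-h/n^2}}{d\mathbb{P}^{(n)}_{1-h_0/n^2}}(X_0,\dots,X_n)\xrightarrow{d}\frac{d\mathbb{Q}_h}{d\mathbb{Q}_{h_0}}(Z)=\exp\left(-\frac{(h-h_0)g(0)\mu_G}{2}\right)\left(\frac{h}{h_0}\right)^Z\quad\text{a.s.}$$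 (with $0^0=1$), while for $h\ge0$ and $h_0=0$ we have, under $\mathbb{P}^{(n)}_{1}$ and with $Z\sim\mathbb{Q}_0$, $$\frac{d\mathbb{P}^{(n)}_{1-h/n^2}}{d\mathbb{P}^{(n)}_{1}}(X_0,\dots,X_n)\xrightarrow{d}\frac{d\mathbb{Q}_h}{d\mathbb{Q}_{0}}(Z)=\exp\left(-\frac{h\,g(0)\mu_G}{2}\right)1\{Z=0\}\quad\text{a.s.}$$ -/

import Mathlib

open MeasureTheory ProbabilityTheory Filter
open scoped NNReal ENNReal

noncomputable section

namespace INAR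

/-! ### The INAR(1) process -/

/-- The sample space of the driving noise: the coordinate `ω t` collects the thinning variables
`(Z_j^{(t+1)})_{j ≥ 1}` (as `(ω t).1`, with `(ω t).1 j` being `Z_{j+1}^{(t+1)}`) and the innovation
`ε_{t+1}` (as `(ω t).2`). -/
abbrev Noise : Type := ℕ → (ℕ → ℕ) × ℕ

/-- The joint law of the noise: all `Z_j^{(t)}` are i.i.d. Bernoulli with success
probability `θ`, independent of the i.i.d. innovations `ε_t` with distribution `G`. -/
def noiseLaw (G : Measure ℕ) (θ : unitInterval) : Measure Noise :=
  Measure.infinitePi fun _ : ℕ =>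
    (Measure.infinitePi fun _ : ℕ => bernoulliMeasure (1 : ℕ) 0 θ).prod G

/-- The INAR(1) process driven by the noise: `X_0 = 0` and
`X_{t+1} = ∑_{j = 1}^{X_t} Z_j^{(t+1)} + ε_{t+1}`. -/
def process : ℕ → Noise → ℕ
  | 0, _ => 0
  | t + 1, ω => (∑ j ∈ Finset.range (process t ω), (ω t).1 j) + (ω t).2

/-- The observed path `(X_0, …, X_n)`. -/
def path (n : ℕ) (ω : Noise) : Fin (n + 1) → ℕ := fun t => process t ω

/-- The law of `(X_0, …, X_n)` for autoregression parameter `θ` and innovation distribution `G`. -/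
def pathLaw (G : Measure ℕ) (n : ℕ) (θ : unitInterval) : Measure (Fin (n + 1) → ℕ) :=
  (noiseLaw G θ).map (path n)

/-- The local parameter `θ_n = 1 - h / n²`; it is cut off at `0` for the finitely many `n` with
`n² < h`, so that it is always an autoregression parameter in `[0, 1]`. -/
def localTheta (n : ℕ) (h : ℝ≥0) : unitInterval :=
  Set.projIcc (0 : ℝ) 1 zero_le_one (1 - (h : ℝ) / (n : ℝ) ^ 2)

/-- The nearly unstable INAR(1) experiments: the law of `(X_0, …, X_n)` with autoregression
parameter `1 - h / n²`. -/
def localLaw (G : Measure ℕ) (n : ℕ) (h : ℝ≥0) : Measure (Fin (n + 1) → ℕ) :=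
  pathLaw G n (localTheta n h)

/-! ### The conditions on the innovation distribution and the limit experiment -/

/-- The mean `μ_G`. -/
def mean (G : Measure ℕ) : ℝ := ∫ k, (k : ℝ) ∂G

/-- The condition on `G`, with probability mass function `g k = G {k}`: either the support of `G`
is `{0, …, M}` for some `M`, or the support is all of `ℕ`, the variance is finite and `g` is
eventually decreasing (in the weak sense). -/
def Admissible (G : Measure ℕ) : Prop :=
  (∃ M : ℕ, {k : ℕ | G {k} ≠ 0} = Set.Icc 0 M) ∨
  ({k : ℕ | G {k} ≠ 0} = Set.univ ∧
    evariance (fun k : ℕ => (k : ℝ)) G < ∞ ∧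
    ∃ M : ℕ, ∀ k : ℕ, M ≤ k → G {k + 1} ≤ G {k})

/-- The limit experiment: `Q_h = Poisson (h g(0) μ_G / 2)`. -/
def limitLaw (G : Measure ℕ) (h : ℝ≥0) : Measure ℕ :=
  poissonMeasure (Real.toNNReal ((h : ℝ) * G.real {0} * mean G / 2))

/-! ### Likelihood ratios and weak convergence of experiments -/

/-- The likelihood ratio `dP/dQ`: the density with respect to `Q` of the part of `P` that is
absolutely continuous with respect to `Q`. -/
def likelihoodRatio {Ω : Type*} [MeasurableSpace Ω] (P Q : Measure Ω) (x : Ω) : ℝ :=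
  (P.rnDeriv Q x).toReal

/-- Convergence of experiments `(P n θ)_θ` to `(Q θ)_θ` in Le Cam's weak topology: for every finite
set `I` of parameters and every parameter `θ₀`, the random vector of likelihood ratios
`(dP n θ / dP n θ₀)_{θ ∈ I}` under `P n θ₀` converges in distribution to the random vector
`(dQ θ / dQ θ₀)_{θ ∈ I}` under `Q θ₀`. -/
def ExperimentsConverge {Θ : Type*} {Ω : ℕ → Type*} [∀ n, MeasurableSpace (Ω n)]
    {Ω' : Type*} [MeasurableSpace Ω']
    (P : (n : ℕ) → Θ → Measure (Ω n)) [∀ n θ, IsProbabilityMeasure (P n θ)]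
    (Q : Θ → Measure Ω') [∀ θ, IsProbabilityMeasure (Q θ)] : Prop :=
  ∀ (I : Finset Θ) (θ₀ : Θ),
    TendstoInDistribution
      (fun (n : ℕ) (x : Ω n) (θ : I) => likelihoodRatio (P n θ) (P n θ₀) x) atTop
      (fun (z : Ω') (θ : I) => likelihoodRatio (Q θ) (Q θ₀) z)
      (fun n => P n θ₀) (Q θ₀)

/-! ### The laws above are probability measures -/

theorem measurable_process (t : ℕ) : Measurable (process t) := by
  induction t with
  | zero => exact measurable_const
  | succ t ih =>
    have h1 : Measurable fun p : ℕ × Noise => ∑ j ∈ Finset.range p.1, (p.2 t).1 j := by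
      refine measurable_from_prod_countable_right fun x => ?_
      refine Finset.measurable_fun_sum (Finset.range x) fun j _ => ?_
      have h0 : Measurable fun ω : Noise => (ω t).1 := by fun_prop
      exact (measurable_pi_apply j).comp h0
    have h2 : Measurable fun ω : Noise => (ω t).2 := by fun_prop
    exact (h1.comp (ih.prodMk measurable_id)).add h2

theorem measurable_path (n : ℕ) : Measurable (path n) :=
  measurable_pi_lambda _ fun t => measurable_process t

instance isProbabilityMeasure_noiseLaw (G : Measure ℕ) [IsProbabilityMeasure G] (θ : unitInterval) :
    IsProbabilityMeasure (noiseLaw G θ) := by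
  unfold noiseLaw; infer_instance

instance isProbabilityMeasure_pathLaw (G : Measure ℕ) [IsProbabilityMeasure G] (n : ℕ)
    (θ : unitInterval) :
    IsProbabilityMeasure (pathLaw G n θ) :=
  Measure.isProbabilityMeasure_map (measurable_path n).aemeasurable

instance isProbabilityMeasure_localLaw (G : Measure ℕ) [IsProbabilityMeasure G] (n : ℕ)
    (h : ℝ≥0) :
    IsProbabilityMeasure (localLaw G n h) := by
  unfold localLaw; infer_instance

instance isProbabilityMeasure_limitLaw (G : Measure ℕ) (h : ℝ≥0) : IsProbabilityMeasure (limitLaw G h) := by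
  unfold limitLaw; infer_instance

end INAR

end

/-! With `θ = 1 - h / n²` the path stays of order `n`, so a step from `x` sees a death with
probability of order `1 / n`, and two deaths in one step are negligible over the whole path. An
upward step by `d` from `x` then has probability about `g(d) (1 - (x h / n²) (1 - g(d+1) / g(d)))`,
and a step down by one about `(x h / n²) g(0)`. Multiplying along a path gives the likelihood
`exp(-h · drift / n²) · h ^ downs · baseWeight`, whose last factor is free of `h`.

The variables `1 - g(k+1) / g(k)` have `G`-mean `g(0)` by telescoping, and `X_t` grows like `μ t`. A
Cesàro argument therefore gives `drift / n² → g(0) μ / 2`, and the likelihood ratio depends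
asymptotically only on the number of downward moves (`exists_localLaw_eq_exp`,
`tendsto_localLaw_goodPath`). Both kinds of admissible `G` enter only through a finite mean and the
comparability `g(d+k) ≤ C g(d)`, which turns absolute errors into relative ones.

The Poisson limit of `downs` needs no separate computation. For `s ≤ 1` the ratio of the laws at `s
h₀` and `h₀` is nearly a constant times `s ^ downs`. The good paths have nearly full mass under both
laws, so this quantity has expectation close to one (`tendsto_integral_limitRatio`). This yields the
Poisson generating function at `s`, and the points `s = 2⁻ᵐ` determine the limit
(`tendsto_singleton_of_tendsto_pgf`). -/

noncomputable section

/-! ### Densities at atoms and convergence of laws on the natural numbers -/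

namespace INAR
open scoped Topology

/-- An atom of `Q` lies outside every `Q`-null set, so the singular part of `P` does not charge it.
-/
theorem likelihoodRatio_eq_div {Ω : Type*} [MeasurableSpace Ω] [MeasurableSingletonClass Ω]
    (P Q : Measure Ω) [IsFiniteMeasure P] [IsFiniteMeasure Q] {x : Ω} (hx : Q {x} ≠ 0) :
    likelihoodRatio P Q x = P.real {x} / Q.real {x} := by
  have hdec := Measure.haveLebesgueDecomposition_add P Q
  have hs : P.singularPart Q {x} = 0 := by
    obtain ⟨s, hs, h1, h2⟩ := Measure.mutuallySingular_singularPart P Q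
    by_cases hxs : x ∈ s
    · exact measure_mono_null (by simpa using hxs) h1
    · exact absurd (measure_mono_null (by simpa using hxs) h2) hx
  have h1 : P {x} = P.rnDeriv Q x * Q {x} := by
    conv_lhs => rw [hdec]
    rw [Measure.add_apply, hs, zero_add, withDensity_apply _ (measurableSet_singleton x),
      lintegral_singleton]
  have h2 : Q.real {x} ≠ 0 := by simpa [measureReal_def, ENNReal.toReal_eq_zero_iff] using hx
  rw [eq_div_iff h2, likelihoodRatio, measureReal_def, measureReal_def, h1, ENNReal.toReal_mul]

theorem integrable_of_abs_le {Ω : Type*} [MeasurableSpace Ω] [DiscreteMeasurableSpace Ω]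
    [Countable Ω]
    (P : Measure Ω) [IsFiniteMeasure P] {f : Ω → ℝ} {M : ℝ} (hf : ∀ x, |f x| ≤ M) :
    Integrable f P :=
  Integrable.of_bound (measurable_of_countable f).aestronglyMeasurable M (ae_of_all _ hf)

theorem hasSum_real_singleton_mul {Ω : Type*} [MeasurableSpace Ω] [DiscreteMeasurableSpace Ω]
    [Countable Ω] (P : Measure Ω) [IsFiniteMeasure P] {f : Ω → ℝ} {M : ℝ}
    (hf : ∀ k, |f k| ≤ M) : HasSum (fun k => P.real {k} * f k) (∫ k, f k ∂P) := by
  have h1 := hasSum_integral_iUnion (μ := P) (f := f)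
    (s := fun k : Ω => {k}) (fun k => measurableSet_singleton k)
    (fun i j hij => by simpa [Function.onFun] using hij)
    (integrable_of_abs_le P hf).integrableOn
  simpa [Set.iUnion_of_singleton, measureReal_def] using h1

theorem hasSum_real_singleton (P : Measure ℕ) [IsProbabilityMeasure P] :
    HasSum (fun k => P.real {k}) 1 := by
  simpa using hasSum_real_singleton_mul P (f := fun _ => 1) (M := 1) (by simp)

/-- Pointwise convergence of probability mass functions on `ℕ` implies convergence of the
integrals of bounded functions. -/
theorem tendsto_integral_of_tendsto_singleton (ν : ℕ → Measure ℕ) (Q : Measure ℕ)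
    [∀ n, IsProbabilityMeasure (ν n)] [IsProbabilityMeasure Q]
    (h : ∀ k, Tendsto (fun n => (ν n).real {k}) atTop (𝓝 (Q.real {k})))
    {f : ℕ → ℝ} {M : ℝ} (hf : ∀ k, |f k| ≤ M) :
    Tendsto (fun n => ∫ k, f k ∂(ν n)) atTop (𝓝 (∫ k, f k ∂Q)) := by
  have hM : 0 ≤ M := (abs_nonneg _).trans (hf 0)
  -- Scheffé's argument: the positive part of `Q - ν n` is dominated by the summable masses of `Q`.
  -- Below, `|ν - Q| = (ν - Q) + 2 (Q - ν)⁺`, and the first term sums to zero.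
  have hpos : Tendsto (fun n => ∑' k, max (Q.real {k} - (ν n).real {k}) 0) atTop
      (𝓝 (∑' k : ℕ, 0)) := by
    refine tendsto_tsum_of_dominated_convergence (bound := fun k => Q.real {k})
      (hasSum_real_singleton Q).summable ?_ ?_
    · intro k
      have := ((tendsto_const_nhds (x := Q.real {k})).sub (h k)).max
        (tendsto_const_nhds (x := (0 : ℝ)))
      simpa using this
    · refine Eventually.of_forall fun n k => ?_
      rw [Real.norm_of_nonneg (le_max_right _ _)]
      exact max_le (by linarith [measureReal_nonneg (μ := ν n) (s := {k})]) measureReal_nonneg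
  rw [tsum_zero] at hpos
  rw [tendsto_iff_dist_tendsto_zero]
  refine squeeze_zero (fun _ => dist_nonneg) (fun n => ?_)
    (g := fun n => 2 * M * ∑' k, max (Q.real {k} - (ν n).real {k}) 0)
    (by simpa using hpos.const_mul (2 * M))
  have hsm : Summable fun k => max (Q.real {k} - (ν n).real {k}) 0 := by
    refine Summable.of_nonneg_of_le (fun _ => le_max_right _ _) (fun k => ?_)
      (hasSum_real_singleton Q).summable
    exact max_le (by linarith [measureReal_nonneg (μ := ν n) (s := {k})]) measureReal_nonneg
  have hd := (hasSum_real_singleton_mul (ν n) hf).sub (hasSum_real_singleton_mul Q hf)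
  have habs : HasSum (fun k => M * ((ν n).real {k} - Q.real {k} +
      2 * max (Q.real {k} - (ν n).real {k}) 0))
      (M * (1 - 1 + 2 * ∑' k, max (Q.real {k} - (ν n).real {k}) 0)) :=
    (((hasSum_real_singleton (ν n)).sub (hasSum_real_singleton Q)).add
      (hsm.hasSum.mul_left 2)).mul_left M
  have hpt : ∀ k, |(ν n).real {k} * f k - Q.real {k} * f k| ≤ M * ((ν n).real {k} - Q.real {k} +
      2 * max (Q.real {k} - (ν n).real {k}) 0) := by
    intro k
    rw [← sub_mul, abs_mul, mul_comm]
    refine mul_le_mul (hf k) ?_ (abs_nonneg _) hM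
    rcases le_total ((ν n).real {k}) (Q.real {k}) with h1 | h1
    · rw [abs_of_nonpos (by linarith), max_eq_left (by linarith)]; linarith
    · rw [abs_of_nonneg (by linarith), max_eq_right (by linarith)]; linarith
  rw [Real.dist_eq, abs_le]
  constructor
  · have := hasSum_le (fun k => (neg_le_of_abs_le (hpt k))) habs.neg hd
    linarith
  · have := hasSum_le (fun k => (le_of_abs_le (hpt k))) hd habs
    linarith

/-- Convergence of probability generating functions at the points `2⁻ᵐ` implies pointwise
convergence of the probability mass functions. -/
theorem tendsto_singleton_of_tendsto_pgf (ν : ℕ → Measure ℕ) (Q : Measure ℕ)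
    [∀ n, IsProbabilityMeasure (ν n)] [IsProbabilityMeasure Q]
    (h : ∀ m : ℕ, Tendsto (fun n => ∫ k, ((1 / 2 : ℝ) ^ m) ^ k ∂(ν n)) atTop
      (𝓝 (∫ k, ((1 / 2 : ℝ) ^ m) ^ k ∂Q))) (k : ℕ) :
    Tendsto (fun n => (ν n).real {k}) atTop (𝓝 (Q.real {k})) := by
  have hu : ∀ j : ℕ, (1 / 2 : ℝ) ^ j ∈ Set.Icc (0 : ℝ) 1 := fun j =>
    ⟨by positivity, pow_le_one₀ (by norm_num) (by norm_num)⟩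
  have hpow : ∀ (m j : ℕ), |((1 / 2 : ℝ) ^ j) ^ m| ≤ 1 := fun m j => by
    rw [abs_of_nonneg (by positivity)]
    exact pow_le_one₀ (hu j).1 (hu j).2
  -- Since `(2⁻ʲ) ^ i = (2⁻ⁱ) ^ j`, the mean of a polynomial in `2⁻ʲ` is a combination of generating
  -- function values.
  have hexp : ∀ (P : Measure ℕ) (_ : IsProbabilityMeasure P) (p : Polynomial ℝ),
      ∫ j, p.eval ((1 / 2 : ℝ) ^ j) ∂P
        = ∑ i ∈ Finset.range (p.natDegree + 1), p.coeff i * ∫ j, ((1 / 2 : ℝ) ^ i) ^ j ∂P := by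
    intro P hP p
    simp_rw [Polynomial.eval_eq_sum_range]
    rw [integral_finsetSum]
    · refine Finset.sum_congr rfl fun i _ => ?_
      rw [integral_const_mul]
      congr 1
      refine integral_congr_ae (ae_of_all _ fun j => ?_)
      simp only
      rw [← pow_mul, ← pow_mul, mul_comm]
    · intro i _
      exact (integrable_of_abs_le P (hpow i)).const_mul _
  have hpoly : ∀ p : Polynomial ℝ, Tendsto (fun n => ∫ j, p.eval ((1 / 2 : ℝ) ^ j) ∂(ν n)) atTop
      (𝓝 (∫ j, p.eval ((1 / 2 : ℝ) ^ j) ∂Q)) := by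
    intro p
    simp_rw [hexp Q inferInstance p, fun n => hexp (ν n) inferInstance p]
    exact tendsto_finsetSum _ fun i _ => (h i).const_mul _
  -- A tent at `2⁻ᵏ` of half-width `2⁻⁽ᵏ⁺¹⁾`. This is the distance to the nearest other power, so on
  -- the powers of one half it is the indicator of `k`. Weierstrass approximation then replaces it
  -- by a polynomial, with an error uniform in `n`.
  set φ : ℝ → ℝ := fun x => max 0 (1 - 2 ^ (k + 1) * |x - (1 / 2) ^ k|) with hφ
  have hφc : Continuous φ := by fun_prop
  have hφk : ∀ j : ℕ, φ ((1 / 2 : ℝ) ^ j) = Set.indicator {k} (fun _ => (1 : ℝ)) j := by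
    intro j
    rcases lt_trichotomy j k with hjk | rfl | hjk
    · rw [Set.indicator_of_notMem (by simpa using hjk.ne)]
      obtain ⟨i, rfl⟩ := Nat.exists_eq_add_of_lt hjk
      refine max_eq_left ?_
      have h1 : (1 / 2 : ℝ) ^ (j + i + 1) ≤ (1 / 2) ^ j * (1 / 2) := by
        rw [pow_succ, pow_add]
        have := pow_le_one₀ (n := i) (by norm_num : (0 : ℝ) ≤ 1 / 2) (by norm_num)
        have h0 : (0 : ℝ) < (1 / 2) ^ j := by positivity
        nlinarith
      have h2 : (2 : ℝ) ^ (j + i + 1 + 1) * (1 / 2) ^ (j + i + 1) = 2 := by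
        rw [pow_succ, mul_right_comm, ← mul_pow]; norm_num
      rw [abs_of_nonneg (by nlinarith [(hu j).1])]
      have h3 : (0 : ℝ) < 2 ^ (j + i + 1 + 1) := by positivity
      nlinarith
    · simp [hφ]
    · rw [Set.indicator_of_notMem (by simpa using hjk.ne')]
      obtain ⟨i, rfl⟩ := Nat.exists_eq_add_of_lt hjk
      refine max_eq_left ?_
      have h1 : (1 / 2 : ℝ) ^ (k + i + 1) ≤ (1 / 2) ^ k * (1 / 2) := by
        rw [pow_succ, pow_add]
        have := pow_le_one₀ (n := i) (by norm_num : (0 : ℝ) ≤ 1 / 2) (by norm_num)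
        have h0 : (0 : ℝ) < (1 / 2) ^ k := by positivity
        nlinarith
      have h2 : (2 : ℝ) ^ (k + 1) * (1 / 2) ^ k = 2 := by
        rw [pow_succ, mul_right_comm, ← mul_pow]; norm_num
      rw [abs_sub_comm, abs_of_nonneg (by nlinarith [(hu k).1])]
      have h3 : (0 : ℝ) < 2 ^ (k + 1) := by positivity
      nlinarith
  have hind : ∀ (P : Measure ℕ) (_ : IsProbabilityMeasure P),
      P.real {k} = ∫ j, φ ((1 / 2 : ℝ) ^ j) ∂P := by
    intro P hP
    simp_rw [hφk]
    rw [integral_indicator_const _ (measurableSet_singleton k)]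
    simp
  simp_rw [hind Q inferInstance, fun n => hind (ν n) inferInstance]
  rw [Metric.tendsto_atTop]
  intro ε hε
  obtain ⟨p, hp⟩ := exists_polynomial_near_of_continuousOn 0 1 φ hφc.continuousOn (ε / 3)
    (by positivity)
  obtain ⟨n₀, hn₀⟩ := Metric.tendsto_atTop.1 (hpoly p) (ε / 3) (by positivity)
  have hφb : ∀ j : ℕ, |φ ((1 / 2 : ℝ) ^ j)| ≤ 1 := fun j => by
    rw [hφk]; by_cases hj : j ∈ ({k} : Set ℕ) <;> simp [hj]
  have hnear : ∀ (P : Measure ℕ) (_ : IsProbabilityMeasure P),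
      |∫ j, p.eval ((1 / 2 : ℝ) ^ j) ∂P - ∫ j, φ ((1 / 2 : ℝ) ^ j) ∂P| ≤ ε / 3 := by
    intro P hP
    have hb : ∀ j : ℕ, |p.eval ((1 / 2 : ℝ) ^ j)| ≤ 1 + ε / 3 := fun j => by
      have h1 := (hp _ (hu j)).le
      have h2 := hφb j
      rw [abs_le] at *
      constructor <;> linarith
    rw [← integral_sub (integrable_of_abs_le P hb) (integrable_of_abs_le P hφb),
      ← Real.norm_eq_abs]
    refine (norm_integral_le_of_norm_le_const (ae_of_all _ fun j => (hp _ (hu j)).le)).trans ?_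
    simp
  refine ⟨n₀, fun n hn => ?_⟩
  have h1 := hn₀ n hn
  have h2 := hnear (ν n) inferInstance
  have h3 := hnear Q inferInstance
  rw [Real.dist_eq, abs_lt] at *
  rw [abs_le] at h2 h3
  constructor <;> linarith

/-- If the integer variables `N n` converge in distribution to `Q` and `Y n` is asymptotically
equal to `Φ (N n)`, then `Y n` converges in distribution to `Φ` under `Q`. -/
theorem tendstoInDistribution_of_tendsto_singleton {Ω : ℕ → Type*} [∀ n, MeasurableSpace (Ω n)]
    [∀ n, Countable (Ω n)] [∀ n, DiscreteMeasurableSpace (Ω n)]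
    {E : Type*} [SeminormedAddCommGroup E] [MeasurableSpace E] [BorelSpace E]
    (P : ∀ n, Measure (Ω n)) [∀ n, IsProbabilityMeasure (P n)] (Q : Measure ℕ)
    [IsProbabilityMeasure Q] (N : ∀ n, Ω n → ℕ) (Y : ∀ n, Ω n → E) (Φ : ℕ → E)
    (hN : ∀ k, Tendsto (fun n => ((P n).map (N n)).real {k}) atTop (𝓝 (Q.real {k})))
    (hY : ∀ ε > 0, Tendsto (fun n => (P n).real {x | ε ≤ ‖Y n x - Φ (N n x)‖}) atTop (𝓝 0)) :
    TendstoInDistribution Y atTop Φ P Q := by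
  have hYm : ∀ n, Measurable (Y n) := fun n => measurable_of_countable _
  have hNm : ∀ n, Measurable (N n) := fun n => measurable_of_countable _
  have hΦm : Measurable Φ := measurable_of_countable _
  have hmap : ∀ n, IsProbabilityMeasure ((P n).map (N n)) := fun n =>
    Measure.isProbabilityMeasure_map (hNm n).aemeasurable
  refine ⟨fun n => (hYm n).aemeasurable, hΦm.aemeasurable, ?_⟩
  refine tendsto_iff_forall_lipschitz_integral_tendsto.2 ?_
  rintro F ⟨M, hM⟩ ⟨L, hL⟩
  have hFc : Continuous F := hL.continuous
  have hFb : ∃ B, ∀ y, |F y| ≤ B := by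
    refine ⟨|F 0| + M, fun y => ?_⟩
    have h1 := hM y 0
    rw [Real.dist_eq] at h1
    have := abs_sub_abs_le_abs_sub (F y) (F 0)
    linarith
  obtain ⟨B, hB⟩ := hFb
  have hM0 : 0 ≤ M := dist_nonneg.trans (hM 0 0)
  have hlim := tendsto_integral_of_tendsto_singleton (fun n => (P n).map (N n)) Q hN
    (f := fun k => F (Φ k)) (fun k => hB _)
  have hfirst : Tendsto (fun n => ∫ x, F (Y n x) ∂(P n) - ∫ x, F (Φ (N n x)) ∂(P n)) atTop
      (𝓝 0) := by
    rw [Metric.tendsto_atTop]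
    intro ε hε
    -- Off the event `η ≤ ‖Y - Φ(N)‖` the Lipschitz bound costs at most `L η ≤ ε / 2`; on it the
    -- oscillation bound `M` of `F` is used. The added ones cover `L = 0` and `M = 0`.
    set η : ℝ := ε / (2 * (L + 1)) with hη
    have hL0 : (0 : ℝ) ≤ L := L.2
    have hη0 : 0 < η := by positivity
    obtain ⟨n₀, hn₀⟩ := Metric.tendsto_atTop.1 (hY η hη0) (ε / (2 * (M + 1))) (by positivity)
    refine ⟨n₀, fun n hn => ?_⟩
    have h1 := hn₀ n hn
    rw [Real.dist_eq, sub_zero, abs_of_nonneg measureReal_nonneg] at h1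
    have hi1 : Integrable (fun x => F (Y n x)) (P n) := integrable_of_abs_le _ fun x => hB _
    have hi2 : Integrable (fun x => F (Φ (N n x))) (P n) := integrable_of_abs_le _ fun x => hB _
    rw [Real.dist_eq, sub_zero, ← integral_sub hi1 hi2]
    set A : Set (Ω n) := {x | η ≤ ‖Y n x - Φ (N n x)‖} with hA
    have hbd : ∀ x, |F (Y n x) - F (Φ (N n x))| ≤ L * η + A.indicator (fun _ => M) x := by
      intro x
      by_cases hx : x ∈ A
      · rw [Set.indicator_of_mem hx]
        have := hM (Y n x) (Φ (N n x))
        rw [Real.dist_eq] at this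
        nlinarith
      · rw [Set.indicator_of_notMem hx, add_zero, ← Real.dist_eq]
        refine (hL.dist_le_mul _ _).trans ?_
        rw [dist_eq_norm]
        exact mul_le_mul_of_nonneg_left (le_of_lt (by simpa [hA] using hx)) hL0
    have hiA : Integrable (A.indicator (fun _ => M)) (P n) :=
      (integrable_const M).indicator (MeasurableSet.of_discrete)
    calc |∫ x, (F (Y n x) - F (Φ (N n x))) ∂(P n)|
        ≤ ∫ x, |F (Y n x) - F (Φ (N n x))| ∂(P n) := abs_integral_le_integral_abs
      _ ≤ ∫ x, (L * η + A.indicator (fun _ => M) x) ∂(P n) :=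
          integral_mono (hi1.sub hi2).abs ((integrable_const _).add hiA) hbd
      _ = L * η + (P n).real A * M := by
          rw [integral_add (integrable_const _) hiA, integral_indicator_const _ .of_discrete]
          simp
      _ < ε := by
          have h2 : L * η ≤ ε / 2 := by
            rw [hη, mul_div_assoc', div_le_div_iff₀ (by positivity) (by norm_num)]
            nlinarith
          have h3 : (P n).real A * M < ε / 2 := by
            have h4 : (P n).real A * (M + 1) < ε / 2 := by
              rw [lt_div_iff₀ (by positivity)] at h1
              linarith
            have : 0 ≤ (P n).real A := measureReal_nonneg
            linarith
          linarith
  have := hfirst.add hlim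
  rw [zero_add] at this
  have h2 : ∀ n, ∫ k, F (Φ k) ∂((P n).map (N n)) = ∫ x, F (Φ (N n x)) ∂(P n) := fun n =>
    integral_map (hNm n).aemeasurable (measurable_of_countable _).aestronglyMeasurable
  simp only [h2, sub_add_cancel] at this
  simp only [ProbabilityMeasure.coe_mk]
  rw [integral_map hΦm.aemeasurable hFc.measurable.aestronglyMeasurable]
  simp_rw [fun n => integral_map (hYm n).aemeasurable
    (hFc.measurable.aestronglyMeasurable (μ := (P n).map (Y n)))]
  exact this

end INAR

/-! ### Thinning and the expansion of one-step transition probabilities -/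

namespace INAR
open scoped Topology

/-- The law of the thinning variables of one time step. -/
def thinLaw (θ : unitInterval) : Measure (ℕ → ℕ) :=
  Measure.infinitePi fun _ : ℕ => bernoulliMeasure (1 : ℕ) 0 θ

instance isProbabilityMeasure_thinLaw (θ : unitInterval) : IsProbabilityMeasure (thinLaw θ) := by
  unfold thinLaw; infer_instance

/-- The number of deaths among the first `m` individuals. -/
def zeros (m : ℕ) (z : ℕ → ℕ) : ℕ := ((Finset.range m).filter fun j => z j = 0).card

theorem measurable_zeros (m : ℕ) : Measurable (zeros m) := by
  have : zeros m = fun z => ∑ j ∈ Finset.range m, if z j = 0 then 1 else 0 := by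
    ext z; exact Finset.card_filter _ _
  rw [this]
  refine Finset.measurable_fun_sum _ fun j _ => ?_
  exact (measurable_of_countable fun k : ℕ => if k = 0 then 1 else 0).comp (measurable_pi_apply j)

theorem zeros_mono {m m' : ℕ} (h : m ≤ m') (z : ℕ → ℕ) : zeros m z ≤ zeros m' z :=
  Finset.card_le_card (Finset.filter_subset_filter _ (by simpa using h))

theorem sum_add_zeros {z : ℕ → ℕ} (hz : ∀ j, z j = 0 ∨ z j = 1) (m : ℕ) :
    (∑ j ∈ Finset.range m, z j) + zeros m z = m := by
  rw [zeros, Finset.card_filter, ← Finset.sum_add_distrib]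
  conv_rhs => rw [← Finset.card_range m, Finset.card_eq_sum_ones]
  refine Finset.sum_congr rfl fun j _ => ?_
  rcases hz j with h | h <;> simp [h]

theorem bernoulliMeasure_zero_real (θ : unitInterval) :
    (bernoulliMeasure (1 : ℕ) 0 θ).real {0} = 1 - θ := by
  rw [bernoulliMeasure_real_apply_of_notMem_of_mem] <;> simp

theorem thinLaw_real_box (θ : unitInterval) (s : Finset ℕ) (t : Set ℕ) :
    (thinLaw θ).real {z | ∀ j ∈ s, z j ∈ t} = (bernoulliMeasure (1 : ℕ) 0 θ).real t ^ s.card := by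
  have h : {z : ℕ → ℕ | ∀ j ∈ s, z j ∈ t} = Set.pi s fun _ => t := by ext; simp [Set.mem_pi]
  rw [h, measureReal_def, thinLaw, Measure.infinitePi_pi _ (fun _ _ => .of_discrete)]
  simp [measureReal_def]

theorem thinLaw_real_zero (θ : unitInterval) (j : ℕ) :
    (thinLaw θ).real {z | z j = 0} = 1 - θ := by
  have := thinLaw_real_box θ {j} {0}
  simpa [bernoulliMeasure_zero_real] using this

theorem thinLaw_real_zeros_eq_zero (θ : unitInterval) (m : ℕ) :
    (thinLaw θ).real {z | zeros m z = 0} = (θ : ℝ) ^ m := by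
  have h := thinLaw_real_box θ (Finset.range m) {0}ᶜ
  rw [Finset.card_range, probReal_compl_eq_one_sub (measurableSet_singleton 0),
    bernoulliMeasure_zero_real, sub_sub_cancel] at h
  rw [← h]
  congr 1
  ext z
  simp [zeros, Finset.filter_eq_empty_iff]

/-- Union bound over ordered pairs of distinct individuals, each pair dying with probability `(1 -
θ) ^ 2`. -/
theorem thinLaw_real_two_le_zeros (θ : unitInterval) (m : ℕ) :
    (thinLaw θ).real {z | 2 ≤ zeros m z} ≤ (m * (1 - (θ : ℝ))) ^ 2 := by
  have hsub : {z : ℕ → ℕ | 2 ≤ zeros m z} ⊆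
      ⋃ p ∈ (Finset.range m).offDiag, {z | z p.1 = 0 ∧ z p.2 = 0} := by
    intro z hz
    obtain ⟨i, hi, j, hj, hij⟩ := Finset.one_lt_card.1 (show 1 < zeros m z from hz)
    simp only [Finset.mem_filter] at hi hj
    simp only [Set.mem_iUnion]
    exact ⟨(i, j), Finset.mem_offDiag.2 ⟨hi.1, hj.1, hij⟩, hi.2, hj.2⟩
  have hpair : ∀ p ∈ (Finset.range m).offDiag,
      (thinLaw θ).real {z | z p.1 = 0 ∧ z p.2 = 0} = (1 - (θ : ℝ)) ^ 2 := by
    intro p hp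
    have := thinLaw_real_box θ {p.1, p.2} {0}
    rw [Finset.card_pair (Finset.mem_offDiag.1 hp).2.2, bernoulliMeasure_zero_real] at this
    simpa using this
  refine (measureReal_mono hsub (measure_ne_top _ _)).trans
    ((measureReal_biUnion_finset_le _ _).trans ?_)
  rw [Finset.sum_congr rfl hpair, Finset.sum_const, nsmul_eq_mul, mul_pow]
  refine mul_le_mul_of_nonneg_right ?_ (sq_nonneg _)
  rw [Finset.offDiag_card, Finset.card_range, ← sq]
  exact_mod_cast Nat.sub_le _ _

theorem thinLaw_ae (θ : unitInterval) : ∀ᵐ z ∂(thinLaw θ), ∀ j, z j = 0 ∨ z j = 1 := by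
  rw [ae_all_iff]
  intro j
  have h := thinLaw_real_box θ {j} {0, 1}ᶜ
  have h0 : (bernoulliMeasure (1 : ℕ) 0 θ).real {0, 1}ᶜ = 0 := by
    rw [bernoulliMeasure_real_apply_of_notMem_of_notMem] <;> simp
  rw [h0] at h
  rw [ae_iff]
  have h1 : (thinLaw θ).real {z | ¬ (z j = 0 ∨ z j = 1)} = 0 := by simpa using h
  exact (measureReal_eq_zero_iff (measure_ne_top _ _)).1 h1

/-- The transition probability of the process. -/
def transition (G : Measure ℕ) (θ : unitInterval) (x y : ℕ) : ℝ :=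
  ((thinLaw θ).prod G).real {p | (∑ j ∈ Finset.range x, p.1 j) + p.2 = y}

theorem measurableSet_transition (x y : ℕ) :
    MeasurableSet {p : (ℕ → ℕ) × ℕ | (∑ j ∈ Finset.range x, p.1 j) + p.2 = y} := by
  have h : Measurable fun p : (ℕ → ℕ) × ℕ => (∑ j ∈ Finset.range x, p.1 j) + p.2 := by
    refine Measurable.add ?_ measurable_snd
    refine Finset.measurable_fun_sum _ fun j _ => ?_
    exact (measurable_pi_apply j).comp measurable_fst
  exact h (measurableSet_singleton y)

/-- The ratio `g (d + 1) / g d`. -/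
def massRatio (G : Measure ℕ) (d : ℕ) : ℝ := G.real {d + 1} / G.real {d}

/-- The mass function is decreasing up to the constant `C`. -/
def AlmostDecreasing (G : Measure ℕ) (C : ℝ) : Prop :=
  1 ≤ C ∧ ∀ d k, G.real {d + k} ≤ C * G.real {d}

variable {G : Measure ℕ} {C : ℝ}

theorem AlmostDecreasing.massRatio_mul (hC : AlmostDecreasing G C) (d : ℕ) :
    massRatio G d * G.real {d} = G.real {d + 1} := by
  by_cases h : G.real {d} = 0
  · have := hC.2 d 1
    rw [h, mul_zero] at this ⊢
    exact (le_antisymm this measureReal_nonneg).symm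
  · exact div_mul_cancel₀ _ h

theorem massRatio_nonneg (d : ℕ) : 0 ≤ massRatio G d :=
  div_nonneg measureReal_nonneg measureReal_nonneg

theorem AlmostDecreasing.massRatio_le (hC : AlmostDecreasing G C) (d : ℕ) :
    massRatio G d ≤ C :=
  div_le_of_le_mul₀ measureReal_nonneg (zero_le_one.trans hC.1) (hC.2 d 1)

theorem AlmostDecreasing.abs_one_sub_massRatio_le (hC : AlmostDecreasing G C) (d : ℕ) :
    |1 - massRatio G d| ≤ C := by
  have h1 := hC.massRatio_le d
  have h2 := massRatio_nonneg (G := G) d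
  have h3 := hC.1
  rw [abs_le]; constructor <;> linarith

variable [IsProbabilityMeasure G]

/-- Fubini, with the survivors counted as `x` minus the deaths; keeping the deaths on the right
avoids truncated subtraction. -/
theorem transition_eq_integral (θ : unitInterval) (x y : ℕ) :
    transition G θ x y = ∫ z, G.real {e | x + e = y + zeros x z} ∂(thinLaw θ) := by
  rw [transition, measureReal_def, Measure.prod_apply (measurableSet_transition x y),
    ← integral_toReal]
  · refine integral_congr_ae ?_
    filter_upwards [thinLaw_ae θ] with z hz
    rw [measureReal_def]
    congr 2
    ext e
    have := sum_add_zeros hz x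
    simp only [Set.mem_preimage, Set.mem_ofPred_eq]
    omega
  · exact (measurable_measure_prodMk_left (measurableSet_transition x y)).aemeasurable
  · exact ae_of_all _ fun z => measure_lt_top _ _

/-- Upper companion of Bernoulli's inequality; together they fix the probability of no death up to a
quadratic error. -/
theorem one_sub_pow_le {η : ℝ} (h0 : 0 ≤ η) (h1 : η ≤ 1) (m : ℕ) :
    (1 - η) ^ m ≤ 1 - m * η + (m * η) ^ 2 := by
  induction m with
  | zero => simp
  | succ m ih =>
    have : (1 - η) ^ (m + 1) ≤ (1 - m * η + (m * η) ^ 2) * (1 - η) := by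
      rw [pow_succ]; exact mul_le_mul_of_nonneg_right ih (by linarith)
    refine this.trans ?_
    have hm : (0 : ℝ) ≤ m := Nat.cast_nonneg m
    have h3 : 0 ≤ η ^ 3 * (m : ℝ) ^ 2 := by positivity
    have h4 : 0 ≤ η ^ 2 * (m : ℝ) := by positivity
    push_cast
    nlinarith [sq_nonneg η]

/-- First-order expansion of the transition probabilities in the number of deaths. -/
theorem abs_transition_sub_le (θ : unitInterval) (x y : ℕ) {M φ₀ φ₁ : ℝ}
    (h0 : G.real {e | x + e = y} = φ₀) (h1 : G.real {e | x + e = y + 1} = φ₁)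
    (hφ₀ : φ₀ ≤ M) (hφ₁ : φ₁ ≤ M)
    (hM : ∀ k, 2 ≤ k → G.real {e | x + e = y + k} ≤ M) :
    |transition G θ x y - (φ₀ * (1 - x * (1 - (θ : ℝ))) + φ₁ * (x * (1 - (θ : ℝ))))|
      ≤ 2 * M * (x * (1 - (θ : ℝ))) ^ 2 := by
  set η : ℝ := 1 - (θ : ℝ) with hη
  set a : ℝ := x * η with ha
  have hη0 : 0 ≤ η := sub_nonneg.2 θ.2.2
  have hη1 : η ≤ 1 := by have := θ.2.1; linarith
  have hθ : (θ : ℝ) = 1 - η := by rw [hη]; ring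
  set A₀ : Set (ℕ → ℕ) := {z | zeros x z = 0} with hA₀
  set A₁ : Set (ℕ → ℕ) := {z | zeros x z = 1} with hA₁
  set A₂ : Set (ℕ → ℕ) := {z | 2 ≤ zeros x z} with hA₂
  have m0 : MeasurableSet A₀ := measurable_zeros x (measurableSet_singleton 0)
  have m1 : MeasurableSet A₁ := measurable_zeros x (measurableSet_singleton 1)
  have m2 : MeasurableSet A₂ := measurable_zeros x (measurableSet_Ici (a := 2))
  have w0 : (thinLaw θ).real A₀ = (1 - η) ^ x := by rw [thinLaw_real_zeros_eq_zero, hθ]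
  have w2 : (thinLaw θ).real A₂ ≤ a ^ 2 := thinLaw_real_two_le_zeros θ x
  have hsum : (thinLaw θ).real A₀ + (thinLaw θ).real A₁ + (thinLaw θ).real A₂ = 1 := by
    rw [← measureReal_union _ m1, ← measureReal_union _ m2]
    · convert probReal_univ (μ := thinLaw θ)
      ext z
      simp only [hA₀, hA₁, hA₂, Set.mem_union, Set.mem_ofPred_eq, Set.mem_univ, iff_true]
      omega
    · rw [Set.disjoint_left]
      intro z hz hz'
      simp only [hA₀, hA₁, hA₂, Set.mem_union, Set.mem_ofPred_eq] at hz hz'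
      omega
    · rw [Set.disjoint_left]
      intro z hz hz'
      simp only [hA₀, hA₁, Set.mem_ofPred_eq] at hz hz'
      omega
  have hlow : 1 - a ≤ (1 - η) ^ x := by
    have := one_add_mul_le_pow (a := -η) (by linarith) x
    rw [← sub_eq_add_neg] at this
    linarith
  have hup : (1 - η) ^ x ≤ 1 - a + a ^ 2 := one_sub_pow_le hη0 hη1 x
  have hi0 : Integrable (A₀.indicator fun _ => φ₀) (thinLaw θ) := (integrable_const _).indicator m0
  have hi1 : Integrable (A₁.indicator fun _ => φ₁) (thinLaw θ) := (integrable_const _).indicator m1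
  have hi2 : Integrable (A₂.indicator fun _ => M) (thinLaw θ) := (integrable_const _).indicator m2
  have hφm : Measurable fun z => G.real {e | x + e = y + zeros x z} :=
    (measurable_of_countable fun k => G.real {e | x + e = y + k}).comp (measurable_zeros x)
  have hiφ : Integrable (fun z => G.real {e | x + e = y + zeros x z}) (thinLaw θ) :=
    Integrable.of_bound hφm.aestronglyMeasurable 1 (ae_of_all _ fun z => by
      rw [Real.norm_of_nonneg measureReal_nonneg]; exact measureReal_le_one)
  have hle : ∀ z, G.real {e | x + e = y + zeros x z} ≤ A₀.indicator (fun _ => φ₀) z +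
      A₁.indicator (fun _ => φ₁) z + A₂.indicator (fun _ => M) z := by
    intro z
    rcases (by omega : zeros x z = 0 ∨ zeros x z = 1 ∨ 2 ≤ zeros x z) with h | h | h
    · simp [hA₀, hA₁, hA₂, h, h0]
    · simp [hA₀, hA₁, hA₂, h, h1]
    · have : zeros x z ≠ 0 := by omega
      have : zeros x z ≠ 1 := by omega
      simp_all
  have hge : ∀ z, A₀.indicator (fun _ => φ₀) z + A₁.indicator (fun _ => φ₁) z ≤
      G.real {e | x + e = y + zeros x z} := by
    intro z
    rcases (by omega : zeros x z = 0 ∨ zeros x z = 1 ∨ 2 ≤ zeros x z) with h | h | h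
    · simp [hA₀, hA₁, h, h0]
    · simp [hA₀, hA₁, h, h1]
    · have : zeros x z ≠ 0 := by omega
      have : zeros x z ≠ 1 := by omega
      simp_all
  have e1 := integral_mono hiφ ((hi0.add hi1).add hi2) hle
  have e2 := integral_mono (hi0.add hi1) hiφ hge
  rw [← transition_eq_integral] at e1 e2
  have e3 : ∫ z, (A₀.indicator (fun _ => φ₀) z + A₁.indicator (fun _ => φ₁) z +
      A₂.indicator (fun _ => M) z) ∂(thinLaw θ) =
      ∫ z, (A₀.indicator (fun _ => φ₀) z + A₁.indicator (fun _ => φ₁) z) ∂(thinLaw θ) +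
        ∫ z, A₂.indicator (fun _ => M) z ∂(thinLaw θ) := integral_add (hi0.add hi1) hi2
  simp only [Pi.add_apply] at e1 e2
  rw [e3, integral_add hi0 hi1, integral_indicator_const _ m0,
    integral_indicator_const _ m1, integral_indicator_const _ m2, smul_eq_mul, smul_eq_mul,
    smul_eq_mul] at e1
  rw [integral_add hi0 hi1, integral_indicator_const _ m0,
    integral_indicator_const _ m1, smul_eq_mul, smul_eq_mul] at e2
  have hφ₀0 : 0 ≤ φ₀ := h0 ▸ measureReal_nonneg
  have hφ₁0 : 0 ≤ φ₁ := h1 ▸ measureReal_nonneg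
  have hw2 : 0 ≤ (thinLaw θ).real A₂ := measureReal_nonneg
  rw [w0] at hsum e1 e2
  generalize (1 - η) ^ x = v₀ at *
  generalize (thinLaw θ).real A₁ = v₁ at *
  generalize (thinLaw θ).real A₂ = v₂ at *
  generalize transition G θ x y = p at *
  -- `v₀`, `v₁`, `v₂` are the probabilities of no, one and several deaths. Here `v₀` exceeds `1 - a`
  -- by at most `a²` and `v₂ ≤ a²`, so `v₁` falls short of `a` by at most `2 a²`. The upper error is
  -- `k1` plus `k2`, the lower error `k3`.
  have k1 : (v₀ - (1 - a)) * φ₀ ≤ a ^ 2 * M :=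
    mul_le_mul (by linarith) hφ₀ hφ₀0 (sq_nonneg a)
  have k2 : v₂ * M ≤ a ^ 2 * M := mul_le_mul_of_nonneg_right w2 (by linarith)
  have k3 : (a - v₁) * φ₁ ≤ 2 * a ^ 2 * M :=
    mul_le_mul (by linarith) hφ₁ hφ₁0 (by positivity)
  have k4 : 0 ≤ (v₀ - (1 - a)) * φ₀ := mul_nonneg (by linarith) hφ₀0
  have k5 : 0 ≤ (a - v₁) * φ₁ := mul_nonneg (by linarith) hφ₁0
  rw [abs_le]
  constructor <;> linarith

/-- Follows from `1 - 1/m ≤ log m ≤ m - 1`. The threshold `1 / 2` gives `1 / (1 - t) ≤ 1 + t + 2 s²`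
for `t = b + e` and `s = |b| + e`. -/
theorem exists_eq_exp {m b e : ℝ} (he : 0 ≤ e) (hm : |m - (1 - b)| ≤ e) (hs : |b| + e ≤ 1 / 2) :
    ∃ u, m = Real.exp u ∧ |u + b| ≤ e + 2 * (|b| + e) ^ 2 := by
  rw [abs_le] at hm
  have hb := abs_le.1 (le_refl |b|)
  have hmpos : 0 < m := by linarith
  refine ⟨Real.log m, (Real.exp_log hmpos).symm, ?_⟩
  have h1 := Real.log_le_sub_one_of_pos hmpos
  have h2 := Real.one_sub_inv_le_log_of_pos hmpos
  set s := |b| + e with hsd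
  have h3 : 1 - (1 - (b + e))⁻¹ ≤ 1 - m⁻¹ := by
    have := inv_anti₀ (by linarith : 0 < 1 - (b + e)) (by linarith : 1 - (b + e) ≤ m)
    linarith
  have h4 : -(b + e) - 2 * s ^ 2 ≤ 1 - (1 - (b + e))⁻¹ := by
    have hpos : 0 < 1 - (b + e) := by linarith
    have hq : (b + e) ^ 2 ≤ s ^ 2 := by
      apply sq_le_sq'
      · linarith
      · linarith
    have : (1 - (b + e))⁻¹ ≤ 1 + (b + e) + 2 * s ^ 2 := by
      rw [inv_le_iff_one_le_mul₀ hpos]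
      nlinarith [mul_nonneg (sq_nonneg s) (by linarith : 0 ≤ 1 / 2 - (b + e))]
    linarith
  rw [abs_le]
  constructor
  · linarith
  · nlinarith [sq_nonneg s]

/-- No death contributes `g(d)` and one death `g(d+1)`; comparability makes the remaining error
small relative to `g(d)`. With `|b| ≤ C a` and `e = 2 C a²`, the factor 6 ensures `|b| + e ≤ 3 C a ≤
1 / 2`, and `2 C a² + 2 (3 C a)² ≤ 20 C² a²`. -/
theorem transition_up (hC : AlmostDecreasing G C) (θ : unitInterval) {x y : ℕ} (hxy : x ≤ y)
    (ha : 6 * C * (x * (1 - (θ : ℝ))) ≤ 1) :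
    ∃ u, transition G θ x y = G.real {y - x} * Real.exp u ∧
      |u + x * (1 - (θ : ℝ)) * (1 - massRatio G (y - x))| ≤
        20 * C ^ 2 * (x * (1 - (θ : ℝ))) ^ 2 := by
  obtain ⟨d, rfl⟩ := Nat.exists_eq_add_of_le hxy
  rw [Nat.add_sub_cancel_left]
  have hset : ∀ k, {e | x + e = x + d + k} = {d + k} := fun k => by ext e; simp; omega
  have hkey := abs_transition_sub_le (G := G) θ x (x + d) (M := C * G.real {d})
    (φ₀ := G.real {d}) (φ₁ := massRatio G d * G.real {d})
    (by simp) (by rw [hset, hC.massRatio_mul])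
    (hC.2 d 0)
    (by rw [hC.massRatio_mul]; exact hC.2 d 1) (fun k _ => by rw [hset]; exact hC.2 d k)
  set a : ℝ := x * (1 - (θ : ℝ)) with hadef
  have ha0 : 0 ≤ a := mul_nonneg (Nat.cast_nonneg _) (sub_nonneg.2 θ.2.2)
  have hC1 := hC.1
  have hCa : 0 ≤ C * a := by positivity
  by_cases hg : G.real {d} = 0
  · refine ⟨-(a * (1 - massRatio G d)), ?_, ?_⟩
    · rw [hg] at hkey ⊢
      simpa using hkey
    · rw [neg_add_cancel, abs_zero]; positivity
  have hgpos : 0 < G.real {d} := lt_of_le_of_ne measureReal_nonneg (Ne.symm hg)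
  have hb : |a * (1 - massRatio G d)| ≤ C * a := by
    rw [abs_mul, abs_of_nonneg ha0, mul_comm]
    exact mul_le_mul_of_nonneg_right (hC.abs_one_sub_massRatio_le d) ha0
  have haa : a ≤ 1 := by nlinarith
  have he : 2 * C * a ^ 2 ≤ 2 * (C * a) := by nlinarith
  obtain ⟨u, hu1, hu2⟩ := exists_eq_exp (m := transition G θ x (x + d) / G.real {d})
    (b := a * (1 - massRatio G d)) (e := 2 * C * a ^ 2) (by positivity)
    (by
      rw [← mul_le_mul_iff_of_pos_right hgpos, ← abs_of_pos hgpos, ← abs_mul, abs_of_pos hgpos]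
      calc _ = _ := by
            congr 1
            rw [sub_mul, div_mul_cancel₀ _ hg]
            ring
        _ ≤ _ := hkey
        _ = _ := by ring)
    (by linarith)
  refine ⟨u, by rw [← hu1, mul_div_cancel₀ _ hg], hu2.trans ?_⟩
  have h3 : (|a * (1 - massRatio G d)| + 2 * C * a ^ 2) ^ 2 ≤ (3 * (C * a)) ^ 2 := by
    apply pow_le_pow_left₀ (by positivity); linarith
  have h4 : C * a ^ 2 ≤ C ^ 2 * a ^ 2 := by
    apply mul_le_mul_of_nonneg_right _ (sq_nonneg a); nlinarith
  nlinarith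

/-- A move down by one needs a death, so the main term is one death and no innovation. Relative
accuracy of order `a` is enough, because good paths have few such moves. -/
theorem transition_down (hC : AlmostDecreasing G C) (θ : unitInterval) {x y : ℕ} (hxy : x = y + 1)
    (ha : 6 * C * (x * (1 - (θ : ℝ))) ≤ 1) :
    ∃ u, transition G θ x y = x * (1 - (θ : ℝ)) * G.real {0} * Real.exp u ∧
      |u| ≤ 10 * C ^ 2 * (x * (1 - (θ : ℝ))) := by
  have hset0 : {e | x + e = y} = ∅ := by ext e; simp; omega
  have hset : ∀ k, {e | x + e = y + (k + 1)} = {k} := fun k => by ext e; simp; omega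
  have hC1 := hC.1
  have hg0 : 0 ≤ G.real {0} := measureReal_nonneg
  have hkey := abs_transition_sub_le (G := G) θ x y (M := C * G.real {0})
    (φ₀ := 0) (φ₁ := G.real {0})
    (by rw [hset0]; simp) (by rw [hset 0]) (by positivity)
    (by nlinarith)
    (fun k hk => by
      obtain ⟨k, rfl⟩ := Nat.exists_eq_add_of_lt (show 0 < k by omega)
      rw [zero_add, hset]; simpa using hC.2 0 k)
  set a : ℝ := x * (1 - (θ : ℝ)) with hadef
  have ha0 : 0 ≤ a := mul_nonneg (Nat.cast_nonneg _) (sub_nonneg.2 θ.2.2)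
  rw [zero_mul, zero_add] at hkey
  by_cases hz : a * G.real {0} = 0
  · refine ⟨0, ?_, by simp; positivity⟩
    have h2 : 2 * (C * G.real {0}) * a ^ 2 = 0 := by
      calc _ = 2 * C * a * (a * G.real {0}) := by ring
        _ = 0 := by rw [hz, mul_zero]
    rw [h2, mul_comm (G.real _), hz, sub_zero] at hkey
    rw [hz, zero_mul]
    exact abs_eq_zero.1 (le_antisymm hkey (abs_nonneg _))
  have hpos : 0 < a * G.real {0} := lt_of_le_of_ne (by positivity) (Ne.symm hz)
  obtain ⟨u, hu1, hu2⟩ := exists_eq_exp (m := transition G θ x y / (a * G.real {0}))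
    (b := 0) (e := 2 * C * a) (by positivity)
    (by
      rw [← mul_le_mul_iff_of_pos_right hpos, ← abs_of_pos hpos, ← abs_mul, abs_of_pos hpos]
      calc _ = _ := by
            congr 1
            rw [sub_mul, div_mul_cancel₀ _ hz]
            ring
        _ ≤ _ := hkey
        _ = _ := by ring)
    (by rw [abs_zero]; linarith)
  refine ⟨u, by rw [← hu1, mul_div_cancel₀ _ hz], ?_⟩
  rw [add_zero, abs_zero, zero_add] at hu2
  refine hu2.trans ?_
  have h4 : C * a ≤ C ^ 2 * a := by
    apply mul_le_mul_of_nonneg_right _ ha0; nlinarith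
  nlinarith [mul_nonneg (by positivity : 0 ≤ C * a) (by linarith : 0 ≤ 1 - 6 * C * a)]

/-- Once the values of the path are prescribed, each step constrains only its own noise coordinate,
so the event is a product set. -/
theorem pathLaw_real_singleton (θ : unitInterval) {n : ℕ} {x : Fin (n + 1) → ℕ} (hx : x 0 = 0) :
    (pathLaw G n θ).real {x} = ∏ t : Fin n, transition G θ (x t.castSucc) (x t.succ) := by
  set y : ℕ → ℕ := fun t => if h : t < n + 1 then x ⟨t, h⟩ else 0 with hy
  have hyx : ∀ t : Fin (n + 1), y t = x t := fun t => by
    simp only [hy, t.2, dite_true]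
  have hpre : path n ⁻¹' {x} = Set.pi (Finset.range n)
      fun t => {p : (ℕ → ℕ) × ℕ | (∑ j ∈ Finset.range (y t), p.1 j) + p.2 = y (t + 1)} := by
    ext ω
    simp only [Set.mem_preimage, Set.mem_singleton_iff, Set.mem_pi, Finset.coe_range, Set.mem_Iio,
      Set.mem_ofPred_eq]
    constructor
    · rintro h t ht
      have h1 : process t ω = y t := by
        have := hyx ⟨t, by omega⟩
        rw [← h] at this; exact this.symm
      have h2 : process (t + 1) ω = y (t + 1) := by
        have := hyx ⟨t + 1, by omega⟩
        rw [← h] at this; exact this.symm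
      rw [← h1, ← h2]; rfl
    · intro h
      have : ∀ t, t < n + 1 → process t ω = y t := by
        intro t
        induction t with
        | zero => intro _; rw [← Fin.val_zero (n + 1), hyx, hx]; rfl
        | succ t ih =>
          intro ht
          rw [← h t (by omega), ← ih (by omega)]; rfl
      ext t
      rw [← hyx t, ← this t t.2]; rfl
  rw [measureReal_def, pathLaw, Measure.map_apply (measurable_path n) (measurableSet_singleton x),
    hpre, noiseLaw, Measure.infinitePi_pi _ (fun t _ => measurableSet_transition _ _),
    ENNReal.toReal_prod, Finset.prod_range]
  refine Finset.prod_congr rfl fun t _ => ?_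
  rw [← hyx t.castSucc, ← hyx t.succ]
  rfl

end INAR

/-! ### The asymptotic likelihood of good paths -/

namespace INAR
open scoped Topology

/-- The number of downward moves of a path. -/
def downs {n : ℕ} (x : Fin (n + 1) → ℕ) : ℕ :=
  (Finset.univ.filter fun t : Fin n => x t.succ < x t.castSucc).card

/-- The first-order coefficient of the log-likelihood at the upward moves of a path. -/
def drift (G : Measure ℕ) {n : ℕ} (x : Fin (n + 1) → ℕ) : ℝ :=
  ∑ t : Fin n, if x t.succ < x t.castSucc then 0
    else (x t.castSucc : ℝ) * (1 - massRatio G (x t.succ - x t.castSucc))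

/-- The parameter-free factor of the asymptotic likelihood of a path. -/
def baseWeight (G : Measure ℕ) {n : ℕ} (x : Fin (n + 1) → ℕ) : ℝ :=
  ∏ t : Fin n, if x t.succ < x t.castSucc then (x t.castSucc : ℝ) * G.real {0} / (n : ℝ) ^ 2
    else G.real {x t.succ - x t.castSucc}

/-- The paths on which the likelihood has the asymptotic form. -/
structure GoodPath (G : Measure ℕ) (m : ℕ) (δ : ℝ) {n : ℕ} (x : Fin (n + 1) → ℕ) : Prop where
  zero : x 0 = 0
  le : ∀ t : Fin n, x t.castSucc ≤ m
  le_succ : ∀ t : Fin n, x t.castSucc ≤ x t.succ + 1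
  downs_le : (downs x : ℝ) ≤ δ * n
  drift_near : |drift G x / (n : ℝ) ^ 2 - G.real {0} * mean G / 2| ≤ δ

theorem one_sub_localTheta {n : ℕ} {h : ℝ≥0} (hn : 0 < n) (hh : (h : ℝ) ≤ (n : ℝ) ^ 2) :
    1 - (localTheta n h : ℝ) = h / (n : ℝ) ^ 2 := by
  have hn' : (0 : ℝ) < (n : ℝ) ^ 2 := by positivity
  have h1 : (h : ℝ) / (n : ℝ) ^ 2 ≤ 1 := (div_le_one hn').2 hh
  have h0 : 0 ≤ (h : ℝ) / (n : ℝ) ^ 2 := by positivity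
  rw [localTheta, Set.projIcc_of_mem _ ⟨by linarith, by linarith⟩]
  simp

theorem eventually_le_sq (r : ℝ) : ∀ᶠ n : ℕ in atTop, r ≤ (n : ℝ) ^ 2 :=
  ((tendsto_pow_atTop two_ne_zero).comp tendsto_natCast_atTop_atTop).eventually_ge_atTop r

variable {G : Measure ℕ} [IsProbabilityMeasure G] {C : ℝ}

/-- The asymptotic form of the likelihood. -/
theorem exists_localLaw_eq_exp (hC : AlmostDecreasing G C) (h : ℝ≥0) (K : ℕ) {δ : ℝ}
    (hδ : 0 < δ) :
    ∃ δ' > 0, ∀ᶠ n : ℕ in atTop, ∀ x : Fin (n + 1) → ℕ, GoodPath G (K * n) δ' x →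
      ∃ u, |u| ≤ δ ∧ (localLaw G n h).real {x} =
        Real.exp u * Real.exp (-(h * (G.real {0} * mean G / 2))) * (h : ℝ) ^ downs x *
          baseWeight G x := by
  have hC1 := hC.1
  have hC0 : 0 ≤ C := zero_le_one.trans hC1
  -- At most `δ' n` downward moves with error `10 C² K h / n` each, plus `h` times the drift error
  -- `δ'`, total at most `B δ' = δ / 2`. The upward errors add up to order `1 / n` and use the other
  -- half.
  set B : ℝ := 10 * C ^ 2 * (K * h) + h + 1 with hB
  have hh0 : (0 : ℝ) ≤ h := h.2
  have hBpos : 0 < B := by positivity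
  refine ⟨δ / 2 / B, by positivity, ?_⟩
  have hlim : Tendsto (fun n : ℕ => 20 * C ^ 2 * (K * h) ^ 2 / (n : ℝ)) atTop (𝓝 0) :=
    tendsto_const_div_atTop_nhds_zero_nat _
  have hlim2 : Tendsto (fun n : ℕ => 6 * C * (K * h) / (n : ℝ)) atTop (𝓝 0) :=
    tendsto_const_div_atTop_nhds_zero_nat _
  filter_upwards [eventually_gt_atTop 0, eventually_le_sq h,
    hlim.eventually_le_const (half_pos hδ), hlim2.eventually_le_const zero_lt_one]
    with n hn hhn hl1 hl2 x hx
  have hnR : (0 : ℝ) < n := by exact_mod_cast hn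
  have hη := one_sub_localTheta hn hhn
  set θ := localTheta n h with hθ
  have ha : ∀ t : Fin n, (x t.castSucc : ℝ) * (1 - (θ : ℝ)) ≤ K * h / n := by
    intro t
    have h1 : (x t.castSucc : ℝ) ≤ K * n := by exact_mod_cast hx.le t
    rw [hη]
    calc (x t.castSucc : ℝ) * ((h : ℝ) / (n : ℝ) ^ 2) ≤ K * n * ((h : ℝ) / (n : ℝ) ^ 2) := by
          gcongr
      _ = K * (h : ℝ) / n := by field_simp
  have ha0 : ∀ t : Fin n, 0 ≤ (x t.castSucc : ℝ) * (1 - (θ : ℝ)) := fun t =>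
    mul_nonneg (Nat.cast_nonneg _) (sub_nonneg.2 θ.2.2)
  have ha6 : ∀ t : Fin n, 6 * C * ((x t.castSucc : ℝ) * (1 - (θ : ℝ))) ≤ 1 := fun t =>
    (mul_le_mul_of_nonneg_left (ha t) (by positivity)).trans (by rw [mul_div_assoc']; exact hl2)
  have hstep : ∀ t : Fin n, ∃ u, transition G θ (x t.castSucc) (x t.succ) =
      Real.exp u * ((if x t.succ < x t.castSucc then (h : ℝ) else 1) *
        (if x t.succ < x t.castSucc then (x t.castSucc : ℝ) * G.real {0} / (n : ℝ) ^ 2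
          else G.real {x t.succ - x t.castSucc})) ∧
      |u + h / (n : ℝ) ^ 2 * (if x t.succ < x t.castSucc then 0
        else (x t.castSucc : ℝ) * (1 - massRatio G (x t.succ - x t.castSucc)))| ≤
        20 * C ^ 2 * (K * h / n) ^ 2 +
          (10 * C ^ 2 * (K * h / n)) * (if x t.succ < x t.castSucc then 1 else 0) := by
    intro t
    split_ifs with hd
    · obtain ⟨u, hu1, hu2⟩ := transition_down hC θ
        (show x t.castSucc = x t.succ + 1 by have := hx.le_succ t; omega) (ha6 t)
      refine ⟨u, ?_, ?_⟩
      · rw [hu1, hη]; ring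
      · rw [mul_zero, add_zero, mul_one]
        have h2 : 10 * C ^ 2 * ((x t.castSucc : ℝ) * (1 - (θ : ℝ))) ≤ 10 * C ^ 2 * (K * h / n) :=
          mul_le_mul_of_nonneg_left (ha t) (by positivity)
        have h3 : 0 ≤ 20 * C ^ 2 * (K * h / n) ^ 2 := by positivity
        linarith
    · obtain ⟨u, hu1, hu2⟩ := transition_up hC θ (not_lt.1 hd) (ha6 t)
      refine ⟨u, ?_, ?_⟩
      · rw [hu1]; ring
      · rw [mul_zero, add_zero]
        have h2 : 20 * C ^ 2 * ((x t.castSucc : ℝ) * (1 - (θ : ℝ))) ^ 2 ≤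
            20 * C ^ 2 * (K * h / n) ^ 2 :=
          mul_le_mul_of_nonneg_left (pow_le_pow_left₀ (ha0 t) (ha t) 2) (by positivity)
        refine le_trans (le_of_eq ?_) (hu2.trans h2)
        rw [hη]
        congr 1
        ring
  choose u hu1 hu2 using hstep
  set c : ℝ := G.real {0} * mean G / 2 with hc
  -- The exponents sum to about `-h · drift / n²`, hence to about `-h c`; the shift leaves only the
  -- error.
  refine ⟨∑ t, u t + h * c, ?_, ?_⟩
  · have hcard : ∑ t : Fin n, (if x t.succ < x t.castSucc then (1 : ℝ) else 0) = downs x := by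
      rw [downs, Finset.sum_boole]
    have h1 : |∑ t, u t + h / (n : ℝ) ^ 2 * drift G x| ≤
        20 * C ^ 2 * (K * h) ^ 2 / (n : ℝ) + 10 * C ^ 2 * (K * h / n) * downs x := by
      rw [drift, Finset.mul_sum, ← Finset.sum_add_distrib]
      refine (Finset.abs_sum_le_sum_abs _ _).trans ((Finset.sum_le_sum fun t _ => hu2 t).trans ?_)
      rw [Finset.sum_add_distrib, Finset.sum_const, ← Finset.mul_sum, hcard, Finset.card_univ,
        Fintype.card_fin, nsmul_eq_mul]
      refine le_of_eq ?_
      field_simp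
    have h2 : 10 * C ^ 2 * (K * h / n) * downs x ≤ 10 * C ^ 2 * (K * h) * (δ / 2 / B) := by
      calc _ ≤ 10 * C ^ 2 * (K * h / n) * (δ / 2 / B * n) :=
            mul_le_mul_of_nonneg_left hx.downs_le (by positivity)
        _ = _ := by field_simp
    have h3 : |(h : ℝ) * (drift G x / (n : ℝ) ^ 2 - c)| ≤ h * (δ / 2 / B) := by
      rw [abs_mul, abs_of_nonneg hh0]
      exact mul_le_mul_of_nonneg_left hx.drift_near hh0
    have h4 : ∑ t, u t + h * c = (∑ t, u t + h / (n : ℝ) ^ 2 * drift G x) -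
        h * (drift G x / (n : ℝ) ^ 2 - c) := by ring
    have h5 : (10 * C ^ 2 * (K * h) + h) * (δ / 2 / B) ≤ δ / 2 := by
      rw [mul_div_assoc', div_le_iff₀ hBpos]
      nlinarith
    rw [h4]
    refine (abs_sub _ _).trans ?_
    linarith
  · rw [localLaw, pathLaw_real_singleton _ hx.zero, Finset.prod_congr rfl fun t _ => hu1 t,
      Finset.prod_mul_distrib, Finset.prod_mul_distrib, ← Real.exp_sum, ← Real.exp_add,
      add_neg_cancel_right, baseWeight, ← mul_assoc]
    congr 2
    rw [downs, ← Finset.prod_const, Finset.prod_filter]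

end INAR

/-! ### Cesàro limits and laws of large numbers for the innovations -/

namespace INAR
open scoped Topology

/-- For `0 < t ≤ n` one has `1 / n ≤ 1 / t`, so the quotient is at most the Cesàro mean of `|u t /
t|`. The term `t = 0` has no such bound, hence `u 0 = 0`. -/
theorem tendsto_sum_abs_div_sq {u : ℕ → ℝ} (h0 : u 0 = 0)
    (hu : Tendsto (fun n : ℕ => u n / n) atTop (𝓝 0)) :
    Tendsto (fun n : ℕ => (∑ t ∈ Finset.range n, |u t|) / (n : ℝ) ^ 2) atTop (𝓝 0) := by
  have h1 : Tendsto (fun n : ℕ => (n : ℝ)⁻¹ * ∑ t ∈ Finset.range n, |u t / t|) atTop (𝓝 0) := by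
    have := hu.abs
    rw [abs_zero] at this
    exact this.cesaro
  refine squeeze_zero (fun n => by positivity) (fun n => ?_) h1
  rw [div_eq_mul_inv, mul_comm, sq, mul_inv, mul_assoc]
  refine mul_le_mul_of_nonneg_left ?_ (by positivity)
  rw [Finset.mul_sum]
  refine Finset.sum_le_sum fun t ht => ?_
  rcases Nat.eq_zero_or_pos t with rfl | ht0
  · simp [h0]
  · have htn : (t : ℝ) ≤ n := by exact_mod_cast (Finset.mem_range.1 ht).le
    have ht0' : (0 : ℝ) < t := by exact_mod_cast ht0
    rw [abs_div, abs_of_pos ht0', div_eq_inv_mul]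
    exact mul_le_mul_of_nonneg_right (inv_anti₀ ht0' htn) (abs_nonneg _)

theorem tendsto_sum_natCast_div_sq :
    Tendsto (fun n : ℕ => (∑ t ∈ Finset.range n, (t : ℝ)) / (n : ℝ) ^ 2) atTop (𝓝 (1 / 2)) := by
  have h1 : Tendsto (fun n : ℕ => 1 / 2 - 1 / 2 / (n : ℝ)) atTop (𝓝 (1 / 2)) := by
    have := (tendsto_const_nhds (x := (1 / 2 : ℝ))).sub
      (tendsto_const_div_atTop_nhds_zero_nat (1 / 2 : ℝ))
    simpa using this
  refine h1.congr' ?_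
  filter_upwards [eventually_gt_atTop 0] with n hn
  have hnR : (0 : ℝ) < n := by exact_mod_cast hn
  have h2 : ∀ m : ℕ, ∑ t ∈ Finset.range m, (t : ℝ) = m * (m - 1) / 2 := by
    intro m
    induction m with
    | zero => simp
    | succ m ih => rw [Finset.sum_range_succ, ih]; push_cast; ring
  rw [h2]
  field_simp

/-- The difference `u t - L * t` is `o(t)`, and bounded weights keep its sum `o(n²)`. -/
theorem tendsto_sum_mul_div_sq {u y : ℕ → ℝ} {L C : ℝ} (h0 : u 0 = 0)
    (hu : Tendsto (fun n : ℕ => u n / n) atTop (𝓝 L)) (hy : ∀ t, |y t| ≤ C) :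
    Tendsto (fun n : ℕ => (∑ t ∈ Finset.range n, u t * y t) / (n : ℝ) ^ 2 -
      L * ((∑ t ∈ Finset.range n, t * y t) / (n : ℝ) ^ 2)) atTop (𝓝 0) := by
  have h1 : Tendsto (fun n : ℕ => (u n - L * n) / n) atTop (𝓝 0) := by
    have := hu.sub_const L
    rw [sub_self] at this
    refine this.congr' ?_
    filter_upwards [eventually_gt_atTop 0] with n hn
    have hnR : (n : ℝ) ≠ 0 := by exact_mod_cast hn.ne'
    field_simp
  have h2 := (tendsto_sum_abs_div_sq (u := fun n => u n - L * n) (by simp [h0]) h1).const_mul C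
  rw [mul_zero] at h2
  refine squeeze_zero_norm (fun n => ?_) h2
  rw [mul_div_assoc', ← sub_div, Finset.mul_sum, ← Finset.sum_sub_distrib,
    Real.norm_eq_abs, abs_div, abs_of_nonneg (sq_nonneg (n : ℝ)), mul_div_assoc',
    Finset.mul_sum]
  refine div_le_div_of_nonneg_right ?_ (sq_nonneg _)
  refine (Finset.abs_sum_le_sum_abs _ _).trans (Finset.sum_le_sum fun t _ => ?_)
  rw [← mul_assoc, ← sub_mul, abs_mul, mul_comm]
  exact mul_le_mul_of_nonneg_right (hy t) (abs_nonneg _)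

/-- Cesàro-type limit of the cross sums of two sequences whose averages converge. -/
theorem tendsto_cross_sum_div_sq {e y : ℕ → ℝ} {μ γ C : ℝ}
    (he : Tendsto (fun n : ℕ => (∑ i ∈ Finset.range n, e i) / n) atTop (𝓝 μ))
    (hyl : Tendsto (fun n : ℕ => (∑ i ∈ Finset.range n, y i) / n) atTop (𝓝 γ))
    (hy : ∀ t, |y t| ≤ C) :
    Tendsto (fun n : ℕ => (∑ t ∈ Finset.range n, (∑ i ∈ Finset.range t, e i) * y t) / (n : ℝ) ^ 2)
      atTop (𝓝 (γ * μ / 2)) := by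
  have h1 := tendsto_sum_mul_div_sq (u := fun t => ∑ i ∈ Finset.range t, e i) (by simp) he hy
  have h2 := tendsto_sum_mul_div_sq (u := fun t => ∑ i ∈ Finset.range t, y i) (y := fun _ => 1)
    (C := 1) (by simp) hyl (by simp)
  have h3 := tendsto_sum_natCast_div_sq.const_mul γ
  have h4 : Tendsto (fun n : ℕ => (∑ t ∈ Finset.range n, ∑ i ∈ Finset.range t, y i) / (n : ℝ) ^ 2)
      atTop (𝓝 (γ / 2)) := by
    have := h2.add h3
    simp only [mul_one] at this
    simpa [div_eq_mul_inv] using this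
  -- Summation by parts: with `Y` the partial sums of `y`, the sum is `(n - 1) Y n - ∑ Y t`, giving
  -- `γ - γ / 2`.
  have h5 : Tendsto (fun n : ℕ => (∑ t ∈ Finset.range n, t * y t) / (n : ℝ) ^ 2)
      atTop (𝓝 (γ / 2)) := by
    have h6 := hyl.div_atTop tendsto_natCast_atTop_atTop
    have h7 := (hyl.sub h6).sub h4
    rw [sub_zero, sub_half] at h7
    refine h7.congr' ?_
    filter_upwards [eventually_gt_atTop 0] with n hn
    have hnR : (n : ℝ) ≠ 0 := by exact_mod_cast hn.ne'
    have h8 : ∀ m : ℕ, ∑ t ∈ Finset.range m, t * y t = (m - 1) * ∑ i ∈ Finset.range m, y i -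
        ∑ t ∈ Finset.range m, ∑ i ∈ Finset.range t, y i := by
      intro m
      induction m with
      | zero => simp
      | succ m ih =>
        rw [Finset.sum_range_succ, ih, Finset.sum_range_succ y,
          Finset.sum_range_succ fun t => ∑ i ∈ Finset.range t, y i]
        push_cast
        ring
    rw [h8]
    field_simp
  have h9 := h1.add (h5.const_mul μ)
  simp only [sub_add_cancel, zero_add] at h9
  convert h9 using 2
  ring

variable {G : Measure ℕ} [IsProbabilityMeasure G] {C : ℝ}

theorem tendsto_average_infinitePi (f : ℕ → ℝ) (hf : Integrable f G) :
    ∀ᵐ e ∂(Measure.infinitePi fun _ : ℕ => G),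
      Tendsto (fun n : ℕ => (∑ i ∈ Finset.range n, f (e i)) / n) atTop (𝓝 (∫ k, f k ∂G)) := by
  have hmp : ∀ i : ℕ, MeasurePreserving (Function.eval i)
      (Measure.infinitePi fun _ : ℕ => G) G := fun i =>
    measurePreserving_eval_infinitePi (fun _ : ℕ => G) i
  have hfm : Measurable f := measurable_of_countable f
  have hind : iIndepFun (fun i (e : ℕ → ℕ) => f (e i)) (Measure.infinitePi fun _ : ℕ => G) :=
    iIndepFun_infinitePi (X := fun _ => f) (fun _ => hfm)
  have hmap : ∀ i : ℕ, (Measure.infinitePi fun _ : ℕ => G).map (fun e : ℕ → ℕ => f (e i)) =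
      G.map f := fun i => by
    conv_rhs => rw [← (hmp i).map_eq, Measure.map_map hfm (hmp i).measurable]
    rfl
  have h := strong_law_ae_real (μ := Measure.infinitePi fun _ : ℕ => G)
    (fun i (e : ℕ → ℕ) => f (e i)) ((hmp 0).integrable_comp_of_integrable hf)
    (fun i j hij => hind.indepFun hij)
    (fun i => ⟨(hfm.comp (hmp i).measurable).aemeasurable,
      (hfm.comp (hmp 0).measurable).aemeasurable, by rw [hmap, hmap]⟩)
  have hint : ∫ e, f (e 0) ∂(Measure.infinitePi fun _ : ℕ => G) = ∫ k, f k ∂G := by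
    conv_rhs => rw [← (hmp 0).map_eq, integral_map (hmp 0).measurable.aemeasurable
      hfm.aestronglyMeasurable]
  rw [hint] at h
  exact h

/-- Weighting by `g` telescopes: the masses `g(k+1)` sum to `1 - g(0)`. This is the source of `g(0)`
in the limiting intensity. -/
theorem integral_one_sub_massRatio (hC : AlmostDecreasing G C) :
    ∫ k, (1 - massRatio G k) ∂G = G.real {0} := by
  have hb : ∀ k, |massRatio G k| ≤ C := fun k => by
    rw [abs_of_nonneg (massRatio_nonneg k)]; exact hC.massRatio_le k
  have hi := integrable_of_abs_le G hb
  rw [integral_sub (integrable_const _) hi]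
  have h2 : HasSum (fun k => G.real {k + 1}) (∫ k, massRatio G k ∂G) := by
    have h1 := hasSum_real_singleton_mul G hb
    simp_rw [mul_comm (G.real _), hC.massRatio_mul] at h1
    exact h1
  have h3 := (hasSum_nat_add_iff (f := fun k => G.real {k}) 1).1 h2
  have h4 := h3.unique (hasSum_real_singleton G)
  simp at h4 ⊢
  linarith

/-- The innovations satisfy the required laws of large numbers with high probability. -/
theorem tendsto_infinitePi_good (hC : AlmostDecreasing G C)
    (hint : Integrable (fun k : ℕ => (k : ℝ)) G) {K : ℕ} (hK : mean G < K) {δ : ℝ} (hδ : 0 < δ) :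
    Tendsto (fun n : ℕ => (Measure.infinitePi fun _ : ℕ => G).real
      {e | ¬ (∑ i ∈ Finset.range n, e i ≤ K * n ∧
        |(∑ t ∈ Finset.range n, (∑ i ∈ Finset.range t, (e i : ℝ)) * (1 - massRatio G (e t))) /
          (n : ℝ) ^ 2 - G.real {0} * mean G / 2| ≤ δ)}) atTop (𝓝 0) := by
  set P := Measure.infinitePi fun _ : ℕ => G with hP
  set A : ℕ → Set (ℕ → ℕ) := fun n => {e | ¬ (∑ i ∈ Finset.range n, e i ≤ K * n ∧
        |(∑ t ∈ Finset.range n, (∑ i ∈ Finset.range t, (e i : ℝ)) * (1 - massRatio G (e t))) /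
          (n : ℝ) ^ 2 - G.real {0} * mean G / 2| ≤ δ)} with hA
  have hAm : ∀ n, MeasurableSet (A n) := by
    intro n
    have hr : ∀ t, Measurable fun e : ℕ → ℕ => 1 - massRatio G (e t) := fun t =>
      (measurable_of_countable fun k => 1 - massRatio G k).comp (measurable_pi_apply t)
    have hr' : ∀ t, Measurable fun e : ℕ → ℕ => (e t : ℝ) := fun t =>
      (measurable_of_countable fun k : ℕ => (k : ℝ)).comp (measurable_pi_apply t)
    refine MeasurableSet.compl (MeasurableSet.inter ?_ ?_)
    · exact measurableSet_le
        (Finset.measurable_fun_sum _ fun i _ => measurable_pi_apply i) measurable_const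
    · have hs : Measurable fun e : ℕ → ℕ => ∑ t ∈ Finset.range n,
          (∑ i ∈ Finset.range t, (e i : ℝ)) * (1 - massRatio G (e t)) :=
        Finset.measurable_fun_sum _ fun t _ =>
          (Finset.measurable_fun_sum _ fun i _ => hr' i).mul (hr t)
      have hs' := ((hs.div_const ((n : ℝ) ^ 2)).sub_const (G.real {0} * mean G / 2)).abs
      exact measurableSet_le hs' measurable_const
  -- Almost surely the bad event eventually fails; dominated convergence of the indicators turns
  -- this into convergence of probabilities.
  have hae : ∀ᵐ e ∂P, Tendsto (fun n => (A n).indicator (fun _ => (1 : ℝ)) e) atTop (𝓝 0) := by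
    filter_upwards [tendsto_average_infinitePi (fun k : ℕ => (k : ℝ)) hint,
      tendsto_average_infinitePi (fun k : ℕ => 1 - massRatio G k)
        (integrable_of_abs_le G hC.abs_one_sub_massRatio_le)] with e h1 h2
    rw [integral_one_sub_massRatio hC] at h2
    have h3 := tendsto_cross_sum_div_sq h1 h2 (fun t => hC.abs_one_sub_massRatio_le (e t))
    refine tendsto_const_nhds.congr' ?_
    filter_upwards [h1.eventually_le_const hK, h3.eventually (Metric.closedBall_mem_nhds _ hδ),
      eventually_gt_atTop 0] with n hn1 hn2 hn0
    have hnR : (0 : ℝ) < n := by exact_mod_cast hn0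
    rw [Set.indicator_of_notMem]
    simp only [hA, Set.mem_ofPred_eq, not_not]
    refine ⟨?_, by simpa [Real.dist_eq, mean] using hn2⟩
    rw [div_le_iff₀ hnR] at hn1
    exact_mod_cast hn1
  have hdom := tendsto_integral_of_dominated_convergence (μ := P)
    (F := fun n => (A n).indicator (fun _ => (1 : ℝ))) (f := fun _ => 0) (fun _ => 1)
    (fun n => (measurable_const.indicator (hAm n)).aestronglyMeasurable) (integrable_const _)
    (fun n => ae_of_all _ fun e => by
      by_cases he : e ∈ A n <;> simp [he]) hae
  simp only [integral_zero] at hdom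
  refine hdom.congr fun n => ?_
  rw [integral_indicator_const _ (hAm n), smul_eq_mul, mul_one]

end INAR

/-! ### Paths are good with high probability -/

namespace INAR
open scoped Topology

theorem integral_zeros (θ : unitInterval) (m : ℕ) :
    Integrable (fun z => (zeros m z : ℝ)) (thinLaw θ) ∧
      ∫ z, (zeros m z : ℝ) ∂(thinLaw θ) = m * (1 - (θ : ℝ)) := by
  have hm : ∀ j : ℕ, MeasurableSet {z : ℕ → ℕ | z j = 0} := fun j =>
    measurable_pi_apply j (measurableSet_singleton 0)
  have hz : (fun z => (zeros m z : ℝ)) = fun z =>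
      ∑ j ∈ Finset.range m, {z : ℕ → ℕ | z j = 0}.indicator (fun _ => (1 : ℝ)) z := by
    ext z
    rw [zeros, Finset.card_filter]
    push_cast
    exact Finset.sum_congr rfl fun j _ => by simp [Set.indicator_apply]
  have hi : ∀ j ∈ Finset.range m,
      Integrable ({z : ℕ → ℕ | z j = 0}.indicator (fun _ => (1 : ℝ))) (thinLaw θ) := fun j _ =>
    (integrable_const _).indicator (hm j)
  rw [hz]
  refine ⟨integrable_finsetSum _ hi, ?_⟩
  rw [integral_finsetSum _ hi]
  simp_rw [integral_indicator_const _ (hm _), thinLaw_real_zero]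
  simp [mul_sub]

variable {G : Measure ℕ} {C : ℝ}

/-- On a typical realisation of the noise the path is a good path. -/
theorem goodPath_of_noise (hC : AlmostDecreasing G C) {n K : ℕ} (hn : 0 < n) {δ : ℝ} {ω : Noise}
    (hz : ∀ t j, (ω t).1 j = 0 ∨ (ω t).1 j = 1)
    (hS : ∑ i ∈ Finset.range n, (ω i).2 ≤ K * n)
    (hW : ∀ t < n, zeros (K * n) (ω t).1 ≤ 1)
    (hB : ∑ t ∈ Finset.range n, (zeros (K * n) (ω t).1 : ℝ) ≤ δ * n)
    (hU : |(∑ t ∈ Finset.range n, (∑ i ∈ Finset.range t, ((ω i).2 : ℝ)) *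
      (1 - massRatio G (ω t).2)) / (n : ℝ) ^ 2 - G.real {0} * mean G / 2| ≤ δ) :
    GoodPath G (K * n) (δ * (1 + C * (1 + 2 * K))) (path n ω) := by
  set X : ℕ → ℕ := fun t => process t ω with hX
  set ε : ℕ → ℕ := fun t => (ω t).2 with hε
  -- `W` counts potential deaths among a fixed number `K n` of individuals. It dominates the actual
  -- deaths `D` while `X t ≤ K n`, and its law does not involve the path.
  set W : ℕ → ℕ := fun t => zeros (K * n) (ω t).1 with hWd
  set D : ℕ → ℕ := fun t => zeros (X t) (ω t).1 with hD
  have hC1 := hC.1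
  have hnR : (0 : ℝ) < n := by exact_mod_cast hn
  have hδ : 0 ≤ δ := (abs_nonneg _).trans hU
  have hfac : δ ≤ δ * (1 + C * (1 + 2 * K)) := by
    have : 0 ≤ δ * (C * (1 + 2 * K)) := by positivity
    linarith
  have hrec : ∀ t, X (t + 1) + D t = X t + ε t := by
    intro t
    have h1 := sum_add_zeros (hz t) (X t)
    have h2 : X (t + 1) = (∑ j ∈ Finset.range (X t), (ω t).1 j) + ε t := rfl
    simp only [hD]
    omega
  have hXS : ∀ t, X t + ∑ i ∈ Finset.range t, D i = ∑ i ∈ Finset.range t, ε i := by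
    intro t
    induction t with
    | zero => rfl
    | succ t ih =>
      rw [Finset.sum_range_succ, Finset.sum_range_succ, ← ih]
      have := hrec t
      omega
  have hSle : ∀ t ≤ n, ∑ i ∈ Finset.range t, ε i ≤ K * n := fun t ht =>
    (Finset.sum_le_sum_of_subset (by simpa using ht)).trans hS
  have hXle : ∀ t ≤ n, X t ≤ K * n := fun t ht => by
    have := hXS t
    have := hSle t ht
    omega
  have hDW : ∀ t < n, D t ≤ W t := fun t ht => zeros_mono (hXle t ht.le) _
  have hDsum : ∀ t ≤ n, ∑ i ∈ Finset.range t, D i ≤ ∑ i ∈ Finset.range n, W i := fun t ht =>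
    (Finset.sum_le_sum fun i hi => hDW i (by have := Finset.mem_range.1 hi; omega)).trans
      (Finset.sum_le_sum_of_subset (by simpa using ht))
  have hB' : ((∑ i ∈ Finset.range n, W i : ℕ) : ℝ) ≤ δ * n := by push_cast; exact hB
  refine ⟨rfl, fun t => hXle t t.2.le, fun t => ?_, ?_, ?_⟩
  · have h1 := hrec t
    have h2 := hDW t t.2
    have h3 : W t ≤ 1 := hW t t.2
    change X t ≤ X (t + 1) + 1
    omega
  · refine le_trans ?_ (hB'.trans (mul_le_mul_of_nonneg_right hfac hnR.le))
    norm_cast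
    rw [downs, Finset.card_filter, ← Fin.sum_univ_eq_sum_range]
    refine Finset.sum_le_sum fun t _ => ?_
    have h1 := hrec t
    have h2 := hDW t t.2
    split_ifs with h
    · change X (t + 1) < X t at h
      omega
    · exact Nat.zero_le _
  · have hdrift : drift G (path n ω) = ∑ t ∈ Finset.range n, if X (t + 1) < X t then 0
        else (X t : ℝ) * (1 - massRatio G (X (t + 1) - X t)) :=
      Fin.sum_univ_eq_sum_range (fun t => if X (t + 1) < X t then 0
        else (X t : ℝ) * (1 - massRatio G (X (t + 1) - X t))) n
    set U : ℝ := ∑ t ∈ Finset.range n, (∑ i ∈ Finset.range t, (ε i : ℝ)) *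
      (1 - massRatio G (ε t)) with hUd
    -- Without a death the increment is the innovation, and `X t` differs from the innovation sum by
    -- the at most `δ n` earlier deaths. With a death `W t ≥ 1`, so the crude bound `2 K n C` is
    -- charged to `W t`. The sum over `t` is at most `δ C (1 + 2 K) n²`.
    have hterm : ∀ t ∈ Finset.range n, |(if X (t + 1) < X t then 0
        else (X t : ℝ) * (1 - massRatio G (X (t + 1) - X t))) -
        (∑ i ∈ Finset.range t, (ε i : ℝ)) * (1 - massRatio G (ε t))| ≤
        δ * n * C + 2 * (K * n) * C * W t := by
      intro t ht
      have htn := Finset.mem_range.1 ht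
      have hSR : ((∑ i ∈ Finset.range t, ε i : ℕ) : ℝ) ≤ K * n := by
        exact_mod_cast hSle t htn.le
      have hXR : (X t : ℝ) ≤ K * n := by exact_mod_cast hXle t htn.le
      have hXS' : (X t : ℝ) + ((∑ i ∈ Finset.range t, D i : ℕ) : ℝ) =
          ((∑ i ∈ Finset.range t, ε i : ℕ) : ℝ) := by exact_mod_cast hXS t
      have hDR : ((∑ i ∈ Finset.range t, D i : ℕ) : ℝ) ≤ δ * n :=
        le_trans (by exact_mod_cast hDsum t htn.le) hB'
      rw [← Nat.cast_sum]
      have hρ := hC.abs_one_sub_massRatio_le (ε t)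
      by_cases hDt : D t = 0
      · have h1 := hrec t
        rw [if_neg (by omega), show X (t + 1) - X t = ε t by omega, ← sub_mul, abs_mul]
        have h2 : |(X t : ℝ) - ((∑ i ∈ Finset.range t, ε i : ℕ) : ℝ)| ≤ δ * n := by
          rw [← hXS', sub_add_cancel_left, abs_neg, abs_of_nonneg (Nat.cast_nonneg _)]
          exact hDR
        have h3 := mul_le_mul h2 hρ (abs_nonneg _) (by positivity)
        have h4 : 0 ≤ 2 * (K * n) * C * (W t : ℝ) := by positivity
        linarith
      · have hW1 : (1 : ℝ) ≤ W t := by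
          have := hDW t htn
          exact_mod_cast (by omega : 1 ≤ W t)
        have h1 : |if X (t + 1) < X t then 0
            else (X t : ℝ) * (1 - massRatio G (X (t + 1) - X t))| ≤ K * n * C := by
          split_ifs
          · rw [abs_zero]; positivity
          · rw [abs_mul, abs_of_nonneg (Nat.cast_nonneg _)]
            exact mul_le_mul hXR (hC.abs_one_sub_massRatio_le _) (abs_nonneg _) (by positivity)
        have h2 : |((∑ i ∈ Finset.range t, ε i : ℕ) : ℝ) * (1 - massRatio G (ε t))| ≤
            K * n * C := by
          rw [abs_mul, abs_of_nonneg (Nat.cast_nonneg _)]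
          exact mul_le_mul hSR hρ (abs_nonneg _) (by positivity)
        refine (abs_sub _ _).trans ((add_le_add h1 h2).trans ?_)
        have h3 : 0 ≤ δ * n * C := by positivity
        have h4 : 2 * (K * n) * C * 1 ≤ 2 * (K * n) * C * (W t : ℝ) :=
          mul_le_mul_of_nonneg_left hW1 (by positivity)
        linarith
    have hdiff : |drift G (path n ω) - U| ≤ δ * (C * (1 + 2 * K)) * (n : ℝ) ^ 2 := by
      rw [hdrift, hUd, ← Finset.sum_sub_distrib]
      refine (Finset.abs_sum_le_sum_abs _ _).trans ((Finset.sum_le_sum hterm).trans ?_)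
      rw [Finset.sum_add_distrib, Finset.sum_const, ← Finset.mul_sum, Finset.card_range,
        nsmul_eq_mul]
      have h1 : 2 * (K * n) * C * ∑ t ∈ Finset.range n, (W t : ℝ) ≤
          2 * (K * n) * C * (δ * n) :=
        mul_le_mul_of_nonneg_left hB (by positivity)
      refine (add_le_add_right h1 _).trans (le_of_eq ?_)
      ring
    have h2 : |drift G (path n ω) / (n : ℝ) ^ 2 - U / (n : ℝ) ^ 2| ≤ δ * (C * (1 + 2 * K)) := by
      rw [← sub_div, abs_div, abs_of_pos (by positivity : (0 : ℝ) < (n : ℝ) ^ 2),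
        div_le_iff₀ (by positivity)]
      exact hdiff
    calc _ ≤ |drift G (path n ω) / (n : ℝ) ^ 2 - U / (n : ℝ) ^ 2| +
          |U / (n : ℝ) ^ 2 - G.real {0} * mean G / 2| := abs_sub_le _ _ _
      _ ≤ _ := by linarith

variable [IsProbabilityMeasure G]

theorem measurePreserving_thinning (θ : unitInterval) (t : ℕ) :
    MeasurePreserving (fun ω : Noise => (ω t).1) (noiseLaw G θ) (thinLaw θ) :=
  measurePreserving_fst.comp
    (measurePreserving_eval_infinitePi (fun _ : ℕ => (thinLaw θ).prod G) t)

/-- The law of the innovations is free of `θ`, so one law of large numbers serves all local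
parameters. -/
theorem measurePreserving_innovations (θ : unitInterval) :
    MeasurePreserving (fun (ω : Noise) t => (ω t).2) (noiseLaw G θ)
      (Measure.infinitePi fun _ : ℕ => G) := by
  refine ⟨measurable_pi_lambda _ fun t => measurable_snd.comp (measurable_pi_apply t), ?_⟩
  have h := Measure.infinitePi_map_pi (fun _ : ℕ => (thinLaw θ).prod G)
    (f := fun _ : ℕ => (Prod.snd : (ℕ → ℕ) × ℕ → ℕ)) (fun _ => measurable_snd)
  have h2 : ((thinLaw θ).prod G).map Prod.snd = G := measurePreserving_snd.map_eq
  simp only [h2] at h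
  exact h

theorem noiseLaw_real_two_le_zeros (θ : unitInterval) (n m : ℕ) :
    (noiseLaw G θ).real {ω | ∃ t < n, 2 ≤ zeros m (ω t).1} ≤ n * (m * (1 - (θ : ℝ))) ^ 2 := by
  have hset : {ω : Noise | ∃ t < n, 2 ≤ zeros m (ω t).1} =
      ⋃ t ∈ Finset.range n, {ω : Noise | 2 ≤ zeros m (ω t).1} := by
    ext ω; simp
  rw [hset]
  refine (measureReal_biUnion_finset_le _ _).trans ?_
  have : ∀ t ∈ Finset.range n, (noiseLaw G θ).real {ω : Noise | 2 ≤ zeros m (ω t).1} ≤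
      (m * (1 - (θ : ℝ))) ^ 2 := by
    intro t _
    refine le_trans (le_of_eq ?_) (thinLaw_real_two_le_zeros θ m)
    exact (measurePreserving_thinning θ t).measureReal_preimage
      (measurable_zeros m (measurableSet_Ici (a := 2))).nullMeasurableSet
  refine (Finset.sum_le_sum this).trans ?_
  simp

theorem noiseLaw_real_sum_zeros (θ : unitInterval) (n m : ℕ) {r : ℝ} (hr : 0 < r) :
    (noiseLaw G θ).real {ω | r ≤ ∑ t ∈ Finset.range n, (zeros m (ω t).1 : ℝ)} ≤
      n * (m * (1 - (θ : ℝ))) / r := by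
  have hi : ∀ t ∈ Finset.range n,
      Integrable (fun ω : Noise => (zeros m (ω t).1 : ℝ)) (noiseLaw G θ) := fun t _ =>
    (measurePreserving_thinning θ t).integrable_comp_of_integrable (integral_zeros θ m).1
  have he : ∀ t, ∫ ω, (zeros m (ω t).1 : ℝ) ∂(noiseLaw G θ) = m * (1 - (θ : ℝ)) := by
    intro t
    rw [← (integral_zeros θ m).2, ← (measurePreserving_thinning (G := G) θ t).map_eq,
      integral_map (measurePreserving_thinning (G := G) θ t).measurable.aemeasurable]
    exact ((measurable_of_countable (fun k : ℕ => (k : ℝ))).comp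
      (measurable_zeros m)).aestronglyMeasurable
  have h := mul_meas_ge_le_integral_of_nonneg (μ := noiseLaw G θ)
    (f := fun ω : Noise => ∑ t ∈ Finset.range n, (zeros m (ω t).1 : ℝ))
    (ae_of_all _ fun ω => by positivity) (integrable_finsetSum _ hi) r
  rw [integral_finsetSum _ hi] at h
  simp_rw [he] at h
  rw [le_div_iff₀ hr, mul_comm]
  simpa using h

/-- Under every local alternative the paths are good with high probability. -/
theorem tendsto_localLaw_goodPath (hC : AlmostDecreasing G C)
    (hint : Integrable (fun k : ℕ => (k : ℝ)) G) {K : ℕ} (hK : mean G < K) (h : ℝ≥0) {δ : ℝ}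
    (hδ : 0 < δ) :
    Tendsto (fun n : ℕ => (localLaw G n h).real {x | ¬ GoodPath G (K * n) δ x}) atTop (𝓝 0) := by
  have hC1 := hC.1
  set F : ℝ := 1 + C * (1 + 2 * K) with hF
  have hFpos : 0 < F := by positivity
  set δ₁ : ℝ := δ / F with hδ₁
  have hδ₁pos : 0 < δ₁ := by positivity
  have hδF : δ₁ * F = δ := div_mul_cancel₀ _ hFpos.ne'
  have l1 := tendsto_infinitePi_good hC hint hK hδ₁pos
  have l2 : Tendsto (fun n : ℕ => (K * (h : ℝ)) ^ 2 / (n : ℝ)) atTop (𝓝 0) :=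
    tendsto_const_div_atTop_nhds_zero_nat _
  have l3 : Tendsto (fun n : ℕ => (K * (h : ℝ) / δ₁) / (n : ℝ)) atTop (𝓝 0) :=
    tendsto_const_div_atTop_nhds_zero_nat _
  have l := (l1.add l2).add l3
  rw [add_zero, add_zero] at l
  refine squeeze_zero' (Eventually.of_forall fun _ => measureReal_nonneg) ?_ l
  filter_upwards [eventually_gt_atTop 0, eventually_le_sq h] with n hn hhn
  have hnR : (0 : ℝ) < n := by exact_mod_cast hn
  have hη := one_sub_localTheta hn hhn
  set θ := localTheta n h with hθ
  set A₁ : Set (ℕ → ℕ) := {e | ¬ (∑ i ∈ Finset.range n, e i ≤ K * n ∧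
        |(∑ t ∈ Finset.range n, (∑ i ∈ Finset.range t, (e i : ℝ)) * (1 - massRatio G (e t))) /
          (n : ℝ) ^ 2 - G.real {0} * mean G / 2| ≤ δ₁)} with hA₁
  have b1 : (noiseLaw G θ).real ((fun (ω : Noise) t => (ω t).2) ⁻¹' A₁) ≤
      (Measure.infinitePi fun _ : ℕ => G).real A₁ := by
    rw [measureReal_def, measureReal_def]
    refine ENNReal.toReal_mono (measure_ne_top _ _) ?_
    exact (measurePreserving_innovations θ).measure_preimage_le A₁
  have b2 := noiseLaw_real_two_le_zeros (G := G) θ n (K * n)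
  have b3 := noiseLaw_real_sum_zeros (G := G) θ n (K * n) (mul_pos hδ₁pos hnR)
  have hae : ∀ᵐ ω ∂(noiseLaw G θ), ∀ t j, (ω t).1 j = 0 ∨ (ω t).1 j = 1 := by
    rw [ae_all_iff]
    exact fun t => (measurePreserving_thinning θ t).quasiMeasurePreserving.ae (thinLaw_ae θ)
  have b0 : (noiseLaw G θ).real {ω : Noise | ¬ ∀ t j, (ω t).1 j = 0 ∨ (ω t).1 j = 1} = 0 := by
    rw [measureReal_def, ae_iff.1 hae, ENNReal.toReal_zero]
  -- A bad path requires atypical innovations, a double death (probability at most `(K h)² / n`),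
  -- more than the allowed number of potential deaths (at most `K h / (δ₁ n)` by Markov), or noise
  -- outside the null-set exception.
  have hsub : path n ⁻¹' {x | ¬ GoodPath G (K * n) δ x} ⊆
      ((((fun (ω : Noise) t => (ω t).2) ⁻¹' A₁) ∪ {ω | ∃ t < n, 2 ≤ zeros (K * n) (ω t).1}) ∪
      {ω | δ₁ * n ≤ ∑ t ∈ Finset.range n, (zeros (K * n) (ω t).1 : ℝ)}) ∪
      {ω : Noise | ¬ ∀ t j, (ω t).1 j = 0 ∨ (ω t).1 j = 1} := by
    intro ω hω
    by_contra hcon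
    simp only [Set.mem_union, not_or] at hcon
    obtain ⟨⟨⟨c1, c2⟩, c3⟩, c4⟩ := hcon
    simp only [hA₁, Set.mem_preimage, Set.mem_ofPred_eq, not_not] at c1 c4
    simp only [Set.mem_ofPred_eq, not_exists, not_and, not_le] at c2 c3
    refine hω ?_
    rw [← hδF]
    exact goodPath_of_noise hC hn c4 c1.1 (fun t ht => Nat.lt_succ_iff.1 (c2 t ht)) c3.le c1.2
  rw [localLaw, pathLaw, measureReal_def, Measure.map_apply (measurable_path n) .of_discrete,
    ← measureReal_def]
  refine (measureReal_mono hsub (measure_ne_top _ _)).trans ?_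
  refine (measureReal_union_le _ _).trans ?_
  rw [b0, add_zero]
  refine (measureReal_union_le _ _).trans (add_le_add ((measureReal_union_le _ _).trans
    (add_le_add b1 (b2.trans (le_of_eq ?_)))) (b3.trans (le_of_eq ?_)))
  · rw [hη]; push_cast; field_simp
  · rw [hη]; push_cast; field_simp

end INAR

/-! ### Admissible innovations and the Poisson experiment -/

namespace INAR
open scoped Topology

/-- For `d ≤ M` the constant makes `C g(d) ≥ 1`, which bounds any mass; beyond `M` monotonicity
suffices. -/
theorem exists_almostDecreasing (G : Measure ℕ) [IsProbabilityMeasure G] (M : ℕ)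
    (h1 : ∀ d ≤ M, G {d} ≠ 0) (h2 : ∀ d k, M < d → G.real {d + k} ≤ G.real {d}) :
    ∃ C, AlmostDecreasing G C := by
  have hnn : ∀ k ∈ Finset.range (M + 1), 0 ≤ (G.real {k})⁻¹ := fun k _ =>
    inv_nonneg.2 measureReal_nonneg
  have hC1 : 1 ≤ 1 + ∑ k ∈ Finset.range (M + 1), (G.real {k})⁻¹ :=
    le_add_of_nonneg_right (Finset.sum_nonneg hnn)
  refine ⟨1 + ∑ k ∈ Finset.range (M + 1), (G.real {k})⁻¹, hC1, fun d k => ?_⟩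
  rcases le_or_gt d M with hd | hd
  · have hpos : 0 < G.real {d} := ENNReal.toReal_pos (h1 d hd) (measure_ne_top _ _)
    have h3 := Finset.single_le_sum hnn (Finset.mem_range.2 (Nat.lt_succ_iff.2 hd))
    have h4 : 1 ≤ (1 + ∑ k ∈ Finset.range (M + 1), (G.real {k})⁻¹) * G.real {d} := by
      calc (1 : ℝ) = (G.real {d})⁻¹ * G.real {d} := (inv_mul_cancel₀ hpos.ne').symm
        _ ≤ _ := mul_le_mul_of_nonneg_right (by linarith) hpos.le
    exact measureReal_le_one.trans h4
  · exact (h2 d k hd).trans (le_mul_of_one_le_left measureReal_nonneg hC1)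

theorem Admissible.exists_almostDecreasing {G : Measure ℕ} [IsProbabilityMeasure G]
    (hG : Admissible G) : ∃ C, AlmostDecreasing G C := by
  rcases hG with ⟨M, hM⟩ | ⟨hs, -, M, hM⟩
  · refine INAR.exists_almostDecreasing G M (fun d hd => ?_) fun d k hd => ?_
    · have : d ∈ {k : ℕ | G {k} ≠ 0} := hM ▸ ⟨Nat.zero_le _, hd⟩
      exact this
    · have : d + k ∉ {k : ℕ | G {k} ≠ 0} := by
        rw [hM]; simp only [Set.mem_Icc, not_and, not_le]; omega
      rw [measureReal_def, not_not.1 this]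
      exact measureReal_nonneg
  · refine INAR.exists_almostDecreasing G M (fun d _ => ?_) fun d k hd => ?_
    · have : d ∈ {k : ℕ | G {k} ≠ 0} := hs ▸ Set.mem_univ d
      exact this
    · refine ENNReal.toReal_mono (measure_ne_top _ _) ?_
      induction k with
      | zero => exact le_rfl
      | succ k ih => exact (hM (d + k) (by omega)).trans ih

theorem Admissible.integrable {G : Measure ℕ} [IsProbabilityMeasure G]
    (hG : Admissible G) : Integrable (fun k : ℕ => (k : ℝ)) G := by
  rcases hG with ⟨M, hM⟩ | ⟨-, hv, -⟩
  · refine Integrable.of_bound (measurable_of_countable _).aestronglyMeasurable M ?_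
    rw [ae_iff_of_countable]
    intro k hk
    have : k ∈ Set.Icc 0 M := hM ▸ hk
    simpa using this.2
  · exact ((evariance_lt_top_iff_memLp
      (measurable_of_countable _).aestronglyMeasurable).1 hv).integrable one_le_two

/-- The limit likelihood ratio as a function of the number of downward moves. -/
def limitRatio (G : Measure ℕ) (h h₀ : ℝ≥0) (z : ℕ) : ℝ :=
  Real.exp (-(((h : ℝ) - h₀) * G.real {0} * mean G / 2)) * ((h : ℝ) / h₀) ^ z

theorem limitRatio_nonneg (G : Measure ℕ) (h h₀ : ℝ≥0) (z : ℕ) : 0 ≤ limitRatio G h h₀ z := by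
  unfold limitRatio; positivity

theorem mean_nonneg (G : Measure ℕ) : 0 ≤ mean G := integral_nonneg fun _ => Nat.cast_nonneg _

theorem coe_limitRate (G : Measure ℕ) (h : ℝ≥0) :
    ((Real.toNNReal ((h : ℝ) * G.real {0} * mean G / 2) : ℝ≥0) : ℝ) =
      (h : ℝ) * G.real {0} * mean G / 2 := by
  rw [Real.coe_toNNReal]
  have := mean_nonneg G
  have : 0 ≤ G.real {0} := measureReal_nonneg
  positivity

/-- Quotient of Poisson weights at atoms. The convention `h / 0 = 0` covers `h₀ = 0`, where `0 ^ z`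
is the indicator of `z = 0`. An atom at `z > 0` forces a nonzero rate, so the common factor cancels.
-/
theorem likelihoodRatio_limitLaw (G : Measure ℕ) (h h₀ : ℝ≥0) :
    likelihoodRatio (limitLaw G h) (limitLaw G h₀) =ᵐ[limitLaw G h₀] limitRatio G h h₀ := by
  rw [Filter.EventuallyEq, ae_iff_of_countable]
  intro z hz
  rw [likelihoodRatio_eq_div _ _ hz]
  have hz' : (limitLaw G h₀).real {z} ≠ 0 := by
    simpa [measureReal_def, ENNReal.toReal_eq_zero_iff] using hz
  rw [limitLaw, limitLaw, poissonMeasure_real_singleton, poissonMeasure_real_singleton,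
    coe_limitRate, coe_limitRate, limitRatio]
  rw [limitLaw, poissonMeasure_real_singleton, coe_limitRate] at hz'
  have hpow : ((h₀ : ℝ) * G.real {0} * mean G / 2) ^ z ≠ 0 := fun h0 => by simp [h0] at hz'
  have hexp : Real.exp (-(((h : ℝ) - h₀) * G.real {0} * mean G / 2)) =
      Real.exp (-(h * G.real {0} * mean G / 2)) / Real.exp (-(h₀ * G.real {0} * mean G / 2)) := by
    rw [← Real.exp_sub]; congr 1; ring
  rw [hexp, div_div_div_cancel_right₀ (by positivity), mul_div_mul_comm, ← div_pow]
  congr 1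
  rcases Nat.eq_zero_or_pos z with rfl | hzpos
  · simp
  · have hbase : (h₀ : ℝ) * (G.real {0} * mean G / 2) ≠ 0 := fun h0 => hpow (by
      rw [mul_assoc, mul_div_assoc, h0, zero_pow hzpos.ne'])
    rw [mul_assoc, mul_div_assoc, mul_assoc (h₀ : ℝ), mul_div_assoc (h₀ : ℝ),
      mul_div_mul_right _ _ (right_ne_zero_of_mul hbase)]

/-! ### Comparison of likelihoods and the Poisson limit of downward moves -/

variable {G : Measure ℕ} [IsProbabilityMeasure G] {C : ℝ}

/-- The exponential is written as the reciprocal of the constant in `limitRatio` for the parameters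
`s * h₀` and `h₀`. -/
theorem integral_pow_limitLaw (G : Measure ℕ) (h₀ : ℝ≥0) (s : ℝ) :
    ∫ k, s ^ k ∂(limitLaw G h₀) = Real.exp ((s * h₀ - h₀) * G.real {0} * mean G / 2) := by
  rw [limitLaw, integral_poissonMeasure]
  set r := Real.toNNReal ((h₀ : ℝ) * G.real {0} * mean G / 2) with hr
  have hrr : (r : ℝ) = (h₀ : ℝ) * G.real {0} * mean G / 2 := coe_limitRate G h₀
  have h1 := (NormedSpace.expSeries_div_hasSum_exp ((r : ℝ) * s)).mul_left (Real.exp (-r))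
  rw [← Real.exp_eq_exp_ℝ, ← Real.exp_add] at h1
  rw [show (s * h₀ - h₀) * G.real {0} * mean G / 2 = -(r : ℝ) + r * s by rw [hrr]; ring,
    ← h1.tsum_eq]
  refine tsum_congr fun n => ?_
  rw [smul_eq_mul, mul_pow]
  ring

/-- On a set of paths of asymptotically full probability the likelihood ratio is asymptotically a
function of the number of downward moves. -/
theorem exists_likelihood_comparison (hC : AlmostDecreasing G C)
    (hint : Integrable (fun k : ℕ => (k : ℝ)) G) (h h₀ : ℝ≥0) {δ : ℝ} (hδ : 0 < δ) :
    ∃ E : ∀ n : ℕ, Set (Fin (n + 1) → ℕ),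
      (∀ h' : ℝ≥0, Tendsto (fun n => (localLaw G n h').real (E n)ᶜ) atTop (𝓝 0)) ∧
      ∀ᶠ n in atTop, ∀ x ∈ E n, ∃ u, |u| ≤ δ ∧
        (0 < h₀ ∨ (localLaw G n h₀).real {x} ≠ 0 ∨ h = h₀ →
          (localLaw G n h).real {x} =
            Real.exp u * limitRatio G h h₀ (downs x) * (localLaw G n h₀).real {x}) := by
  obtain ⟨K, hK⟩ := exists_nat_gt (mean G)
  obtain ⟨δ₁, hδ₁, e₁⟩ := exists_localLaw_eq_exp hC h K (half_pos hδ)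
  obtain ⟨δ₀, hδ₀, e₀⟩ := exists_localLaw_eq_exp hC h₀ K (half_pos hδ)
  refine ⟨fun n => {x | GoodPath G (K * n) δ₁ x} ∩ {x | GoodPath G (K * n) δ₀ x}, ?_, ?_⟩
  · intro h'
    have l := (tendsto_localLaw_goodPath hC hint hK h' hδ₁).add
      (tendsto_localLaw_goodPath hC hint hK h' hδ₀)
    rw [add_zero] at l
    refine squeeze_zero (fun _ => measureReal_nonneg) (fun n => ?_) l
    rw [Set.compl_inter]
    exact measureReal_union_le _ _
  · filter_upwards [e₁, e₀] with n h1 h0 x hx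
    obtain ⟨u₁, hu₁, p₁⟩ := h1 x hx.1
    obtain ⟨u₀, hu₀, p₀⟩ := h0 x hx.2
    refine ⟨u₁ - u₀, (abs_sub _ _).trans (by linarith), fun hcase => ?_⟩
    -- The power vanishes only for `h₀ = 0` and a path with downward moves. Such a path is null
    -- under `h₀`, and it may carry mass under `h ≠ h₀`; the case hypothesis excludes this.
    by_cases hpow : (h₀ : ℝ) ^ downs x = 0
    · have hp0 : (localLaw G n h₀).real {x} = 0 := by rw [p₀, hpow]; ring
      rcases hcase with hc | hc | hc
      · exact absurd hpow (pow_ne_zero _ (by exact_mod_cast hc.ne'))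
      · exact absurd hp0 hc
      · rw [hc, hp0, mul_zero]
    · rw [p₁, p₀, limitRatio, div_pow, Real.exp_sub,
        show -(((h : ℝ) - h₀) * G.real {0} * mean G / 2) =
          -(h * (G.real {0} * mean G / 2)) - -(h₀ * (G.real {0} * mean G / 2)) by ring,
        Real.exp_sub]
      field_simp

theorem abs_exp_sub_one_le_of_abs_le {u δ : ℝ} (hu : |u| ≤ δ) :
    |Real.exp u - 1| ≤ Real.exp δ - 1 := by
  obtain ⟨h1, h2⟩ := abs_le.1 hu
  have e1 := Real.exp_le_exp.2 h2
  have e2 := Real.exp_le_exp.2 h1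
  have e3 : 2 ≤ Real.exp δ + Real.exp (-δ) := by
    rw [Real.exp_neg, ← sub_nonneg]
    have : Real.exp δ + (Real.exp δ)⁻¹ - 2 = (Real.exp δ - 1) ^ 2 / Real.exp δ := by
      field_simp; ring
    rw [this]; positivity
  rw [abs_le]; constructor <;> linarith

/-- The likelihood ratio is asymptotically a function of the number of downward moves. -/
theorem tendsto_likelihoodRatio_sub (hC : AlmostDecreasing G C)
    (hint : Integrable (fun k : ℕ => (k : ℝ)) G) (h h₀ : ℝ≥0) {ε : ℝ} (hε : 0 < ε) :
    Tendsto (fun n => (localLaw G n h₀).real {x | ε ≤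
      ‖likelihoodRatio (localLaw G n h) (localLaw G n h₀) x - limitRatio G h h₀ (downs x)‖})
      atTop (𝓝 0) := by
  rw [Metric.tendsto_atTop']
  intro η hη
  -- Then `exp δ - 1 = ε η / 2`. By Markov the likelihood ratio is below `2 / η` outside an event of
  -- probability at most `η / 2`, and there the multiplicative error becomes an additive one below
  -- `ε`.
  set δ : ℝ := Real.log (1 + ε * (η / 2)) with hδ
  have hδpos : 0 < δ := Real.log_pos (by linarith [mul_pos hε (half_pos hη)])
  have hexp : Real.exp δ - 1 = ε * (η / 2) := by
    rw [hδ, Real.exp_log (by positivity)]; ring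
  obtain ⟨E, hE, hcmp⟩ := exists_likelihood_comparison hC hint h h₀ hδpos
  obtain ⟨n₀, hn₀⟩ := eventually_atTop.1 (hcmp.and ((hE h₀).eventually_lt_const (half_pos hη)))
  refine ⟨n₀, fun n hn => ?_⟩
  obtain ⟨h1, h2⟩ := hn₀ n hn.le
  set P := localLaw G n h
  set P₀ := localLaw G n h₀
  have hmark : P₀.real {x | 2 / η ≤ likelihoodRatio P P₀ x} ≤ η / 2 := by
    have h3 := mul_meas_ge_le_integral_of_nonneg (μ := P₀) (f := likelihoodRatio P P₀)
      (ae_of_all _ fun x => ENNReal.toReal_nonneg) Measure.integrable_toReal_rnDeriv (2 / η)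
    have h4 : ∫ x, likelihoodRatio P P₀ x ∂P₀ ≤ 1 := by
      refine (Measure.integral_toReal_rnDeriv' (μ := P)).trans_le ?_
      rw [probReal_univ]
      exact sub_le_self _ measureReal_nonneg
    have h5 := h3.trans h4
    rw [div_mul_eq_mul_div, div_le_one hη] at h5
    linarith
  have hnull : P₀.real {x | ¬ P₀ {x} ≠ 0} = 0 := by
    rw [measureReal_def]
    have : ∀ᵐ x ∂P₀, P₀ {x} ≠ 0 := by rw [ae_iff_of_countable]; exact fun x hx => hx
    rw [ae_iff.1 this, ENNReal.toReal_zero]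
  have hsub : {x | ε ≤ ‖likelihoodRatio P P₀ x - limitRatio G h h₀ (downs x)‖} ⊆
      ((E n)ᶜ ∪ {x | 2 / η ≤ likelihoodRatio P P₀ x}) ∪ {x | ¬ P₀ {x} ≠ 0} := by
    intro x hx
    by_contra hcon
    simp only [Set.mem_union, not_or, Set.mem_compl_iff, not_not, Set.mem_ofPred_eq, not_le]
      at hcon hx
    obtain ⟨⟨c1, c2⟩, c3⟩ := hcon
    obtain ⟨u, hu, hp⟩ := h1 x c1
    have hp0 : P₀.real {x} ≠ 0 := by
      simpa [measureReal_def, ENNReal.toReal_eq_zero_iff] using c3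
    have hL : likelihoodRatio P P₀ x = Real.exp u * limitRatio G h h₀ (downs x) := by
      rw [likelihoodRatio_eq_div P P₀ c3, hp (Or.inr (Or.inl hp0)), mul_div_cancel_right₀ _ hp0]
    have hF : limitRatio G h h₀ (downs x) = Real.exp (-u) * likelihoodRatio P P₀ x := by
      rw [hL, ← mul_assoc, ← Real.exp_add, neg_add_cancel, Real.exp_zero, one_mul]
    have hL0 : 0 ≤ likelihoodRatio P P₀ x := ENNReal.toReal_nonneg
    have h6 : ‖likelihoodRatio P P₀ x - limitRatio G h h₀ (downs x)‖ ≤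
        ε * (η / 2) * likelihoodRatio P P₀ x := by
      rw [hF, Real.norm_eq_abs, abs_sub_comm, ← sub_one_mul, abs_mul, abs_of_nonneg hL0, ← hexp]
      exact mul_le_mul_of_nonneg_right (abs_exp_sub_one_le_of_abs_le (by rwa [abs_neg])) hL0
    have h7 : ε * (η / 2) * likelihoodRatio P P₀ x < ε * (η / 2) * (2 / η) :=
      mul_lt_mul_of_pos_left c2 (by positivity)
    have h8 : ε * (η / 2) * (2 / η) = ε := by field_simp
    linarith
  rw [Real.dist_eq, sub_zero, abs_of_nonneg measureReal_nonneg]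
  refine (measureReal_mono hsub (measure_ne_top _ _)).trans_lt ?_
  refine (measureReal_union_le _ _).trans_lt ?_
  rw [hnull, add_zero]
  refine (measureReal_union_le _ _).trans_lt ?_
  linarith

/-- The limit likelihood ratios have asymptotically unit mass. -/
theorem tendsto_integral_limitRatio (hC : AlmostDecreasing G C)
    (hint : Integrable (fun k : ℕ => (k : ℝ)) G) {h h₀ : ℝ≥0} (hle : h ≤ h₀)
    (hcase : 0 < h₀ ∨ h = h₀) :
    Tendsto (fun n => ∫ x, limitRatio G h h₀ (downs x) ∂(localLaw G n h₀)) atTop (𝓝 1) := by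
  set B : ℝ := Real.exp (-(((h : ℝ) - h₀) * G.real {0} * mean G / 2)) with hB
  -- Since `h ≤ h₀` the limit ratio is bounded, so paths outside `E n` contribute at most `B` times
  -- their vanishing probability.
  have hFB : ∀ z, limitRatio G h h₀ z ≤ B := fun z => by
    refine mul_le_of_le_one_right (Real.exp_pos _).le (pow_le_one₀ (by positivity) ?_)
    exact div_le_one_of_le₀ (by exact_mod_cast hle) h₀.2
  have hB0 : 0 < B := Real.exp_pos _
  rw [Metric.tendsto_atTop']
  intro η hη
  set δ : ℝ := Real.log (1 + η / 3) with hδ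
  have hδpos : 0 < δ := Real.log_pos (by linarith)
  have hexp : Real.exp δ - 1 = η / 3 := by
    rw [hδ, Real.exp_log (by positivity)]; ring
  obtain ⟨E, hE, hcmp⟩ := exists_likelihood_comparison hC hint h h₀ hδpos
  obtain ⟨n₀, hn₀⟩ := eventually_atTop.1 ((hcmp.and ((hE h₀).eventually_lt_const
    (by positivity : 0 < η / 3 / B))).and ((hE h).eventually_lt_const
      (by positivity : 0 < η / 3)))
  refine ⟨n₀, fun n hn => ?_⟩
  obtain ⟨⟨h1, h2⟩, h3⟩ := hn₀ n hn.le
  set P := localLaw G n h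
  set P₀ := localLaw G n h₀
  have hmE : MeasurableSet (E n) := .of_discrete
  set f : (Fin (n + 1) → ℕ) → ℝ := fun x => limitRatio G h h₀ (downs x) with hf
  have hf0 : ∀ x, 0 ≤ f x := fun x => limitRatio_nonneg _ _ _ _
  have hfi : Integrable f P₀ := integrable_of_abs_le P₀ (M := B) fun x => by
    rw [abs_of_nonneg (hf0 x)]; exact hFB _
  have hsplit : ∫ x, f x ∂P₀ = ∫ x in E n, f x ∂P₀ + ∫ x in (E n)ᶜ, f x ∂P₀ :=
    (integral_add_compl hmE hfi).symm
  have hcompl0 : 0 ≤ ∫ x in (E n)ᶜ, f x ∂P₀ := integral_nonneg hf0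
  have hcompl : ∫ x in (E n)ᶜ, f x ∂P₀ < η / 3 := by
    have : ∫ x in (E n)ᶜ, f x ∂P₀ ≤ ∫ x in (E n)ᶜ, B ∂P₀ :=
      integral_mono hfi.integrableOn (integrable_const _) fun x => hFB _
    rw [setIntegral_const, smul_eq_mul] at this
    rw [lt_div_iff₀ hB0] at h2
    linarith
  -- On `E n` the weights `f x * P₀ {x}` and `P {x}` agree up to a factor `exp δ`, so the integral
  -- over `E n` is compared with `P (E n)`, which is close to one.
  have hterm : ∀ x ∈ E n, P.real {x} ≤ Real.exp δ * (f x * P₀.real {x}) ∧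
      f x * P₀.real {x} ≤ Real.exp δ * P.real {x} := by
    intro x hx
    obtain ⟨u, hu, hp⟩ := h1 x hx
    have hp' := hp (by tauto)
    obtain ⟨hu1, hu2⟩ := abs_le.1 hu
    have hq : 0 ≤ f x * P₀.real {x} := mul_nonneg (hf0 x) measureReal_nonneg
    rw [hp', mul_assoc]
    refine ⟨mul_le_mul_of_nonneg_right (Real.exp_le_exp.2 hu2) hq, ?_⟩
    rw [← mul_assoc, ← Real.exp_add]
    exact le_mul_of_one_le_left hq (Real.one_le_exp (by linarith))
  have hsumE : HasSum (fun x => (E n).indicator (fun x => f x * P₀.real {x}) x)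
      (∫ x in E n, f x ∂P₀) := by
    rw [← integral_indicator hmE]
    convert hasSum_real_singleton_mul P₀ (f := (E n).indicator f) (M := B) fun x => ?_ using 2
      with x
    · by_cases hx : x ∈ E n <;> simp [hx, mul_comm]
    · by_cases hx : x ∈ E n
      · rw [Set.indicator_of_mem hx, abs_of_nonneg (hf0 x)]; exact hFB _
      · rw [Set.indicator_of_notMem hx, abs_zero]; exact hB0.le
  have hsumP : HasSum (fun x => (E n).indicator (fun x => P.real {x}) x) (P.real (E n)) := by
    have h4 := hasSum_real_singleton_mul P (f := (E n).indicator fun _ => 1) (M := 1) fun x => by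
      by_cases hx : x ∈ E n <;> simp [hx]
    rw [integral_indicator_const _ hmE, smul_eq_mul, mul_one] at h4
    convert h4 using 2 with x
    by_cases hx : x ∈ E n <;> simp [hx]
  have hJ1 : P.real (E n) ≤ Real.exp δ * ∫ x in E n, f x ∂P₀ := by
    refine hasSum_le (fun x => ?_) hsumP (hsumE.mul_left _)
    by_cases hx : x ∈ E n
    · simpa [hx] using (hterm x hx).1
    · simp [hx]
  have hJ2 : ∫ x in E n, f x ∂P₀ ≤ Real.exp δ * P.real (E n) := by
    refine hasSum_le (fun x => ?_) hsumE (hsumP.mul_left _)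
    by_cases hx : x ∈ E n
    · simpa [hx] using (hterm x hx).2
    · simp [hx]
  have hq : P.real (E n)ᶜ = 1 - P.real (E n) := probReal_compl_eq_one_sub hmE
  have hq1 : P.real (E n) ≤ 1 := measureReal_le_one
  have hq0 : 0 ≤ P.real (E n) := measureReal_nonneg
  have hexp' : Real.exp δ = 1 + η / 3 := by linarith
  rw [hexp'] at hJ1 hJ2
  rw [hsplit, Real.dist_eq, abs_lt]
  generalize ∫ x in E n, f x ∂P₀ = J at *
  constructor
  · by_contra hcon
    have : J ≤ 1 - η := by linarith
    nlinarith
  · nlinarith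

/-- The number of downward moves is asymptotically Poisson distributed. -/
theorem tendsto_map_downs_singleton (hC : AlmostDecreasing G C)
    (hint : Integrable (fun k : ℕ => (k : ℝ)) G) (h₀ : ℝ≥0) (k : ℕ) :
    Tendsto (fun n => ((localLaw G n h₀).map downs).real {k}) atTop
      (𝓝 ((limitLaw G h₀).real {k})) := by
  have hdm : ∀ n, Measurable (downs (n := n)) := fun n => measurable_of_countable _
  have : ∀ n, IsProbabilityMeasure ((localLaw G n h₀).map downs) := fun n =>
    Measure.isProbabilityMeasure_map (hdm n).aemeasurable
  refine tendsto_singleton_of_tendsto_pgf _ _ (fun m => ?_) k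
  have hmap : ∀ n, ∫ k, ((1 / 2 : ℝ) ^ m) ^ k ∂((localLaw G n h₀).map downs) =
      ∫ x, ((1 / 2 : ℝ) ^ m) ^ (downs x) ∂(localLaw G n h₀) := fun n =>
    integral_map (hdm n).aemeasurable (measurable_of_countable _).aestronglyMeasurable
  simp_rw [hmap]
  rw [integral_pow_limitLaw]
  have hs0 : (0 : ℝ) < (1 / 2) ^ m := by positivity
  have hs1 : (1 / 2 : ℝ) ^ m ≤ 1 := pow_le_one₀ (by norm_num) (by norm_num)
  have hpow : ∀ j : ℕ, |((1 / 2 : ℝ) ^ m) ^ j| ≤ 1 := fun j => by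
    rw [abs_of_nonneg (by positivity)]; exact pow_le_one₀ hs0.le hs1
  rcases eq_or_ne h₀ 0 with rfl | hh₀
  · have h1 := tendsto_integral_limitRatio hC hint (le_refl (0 : ℝ≥0)) (Or.inr rfl)
    simp only [NNReal.coe_zero, mul_zero, sub_zero, zero_mul, zero_div, Real.exp_zero]
    refine tendsto_of_tendsto_of_tendsto_of_le_of_le h1 tendsto_const_nhds (fun n => ?_)
      (fun n => ?_)
    · refine integral_mono (integrable_of_abs_le _ (M := 1) fun x => ?_)
        (integrable_of_abs_le _ fun x => hpow _) fun x => ?_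
      · rcases Nat.eq_zero_or_pos (downs x) with h2 | h2
        · simp [limitRatio, h2]
        · simp [limitRatio, h2.ne']
      · rcases Nat.eq_zero_or_pos (downs x) with h2 | h2
        · simp [limitRatio, h2]
        · simp [limitRatio, h2.ne']
    · refine (integral_mono (integrable_of_abs_le _ fun x => hpow _) (integrable_const (1 : ℝ))
        fun x => pow_le_one₀ hs0.le hs1).trans ?_
      simp
  · set s : ℝ≥0 := (1 / 2) ^ m with hs
    have hsR : (s : ℝ) = (1 / 2) ^ m := by simp [hs]
    -- Against the parameter `s * h₀` the limit ratio is a constant times `s ^ downs`, so its unit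
    -- mass gives the generating function at `s`.
    have hle : s * h₀ ≤ h₀ :=
      mul_le_of_le_one_left h₀.2 (by rw [← NNReal.coe_le_coe, hsR]; simpa using hs1)
    have h1 := tendsto_integral_limitRatio hC hint hle (Or.inl (pos_iff_ne_zero.2 hh₀))
    have h2 := h1.const_mul (Real.exp ((((1 / 2 : ℝ) ^ m) * h₀ - h₀) * G.real {0} * mean G / 2))
    rw [mul_one] at h2
    refine h2.congr fun n => ?_
    rw [← integral_const_mul]
    refine integral_congr_ae (ae_of_all _ fun x => ?_)
    have hh₀R : (h₀ : ℝ) ≠ 0 := by exact_mod_cast hh₀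
    simp only [limitRatio]
    rw [NNReal.coe_mul, hsR, mul_div_cancel_right₀ _ hh₀R, ← mul_assoc, ← Real.exp_add,
      add_neg_cancel, Real.exp_zero, one_mul]

theorem tendstoInDistribution_likelihoodRatio (hC : AlmostDecreasing G C)
    (hint : Integrable (fun k : ℕ => (k : ℝ)) G) (h h₀ : ℝ≥0) :
    TendstoInDistribution
      (fun n => likelihoodRatio (localLaw G n h) (localLaw G n h₀)) atTop
      (limitRatio G h h₀) (fun n => localLaw G n h₀) (limitLaw G h₀) :=
  tendstoInDistribution_of_tendsto_singleton (fun n => localLaw G n h₀) (limitLaw G h₀)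
    (fun _ => downs) _ _ (tendsto_map_downs_singleton hC hint h₀)
    fun _ hε => tendsto_likelihoodRatio_sub hC hint h h₀ hε

theorem experimentsConverge_localLaw (hC : AlmostDecreasing G C)
    (hint : Integrable (fun k : ℕ => (k : ℝ)) G) :
    ExperimentsConverge (localLaw G) (limitLaw G) := by
  intro I h₀
  have hmain : TendstoInDistribution
      (fun (n : ℕ) (x : Fin (n + 1) → ℕ) (h : I) =>
        likelihoodRatio (localLaw G n h) (localLaw G n h₀) x) atTop
      (fun (z : ℕ) (h : I) => limitRatio G h h₀ z)
      (fun n => localLaw G n h₀) (limitLaw G h₀) := by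
    refine tendstoInDistribution_of_tendsto_singleton (fun n => localLaw G n h₀) (limitLaw G h₀)
      (fun _ => downs) _ _ (tendsto_map_downs_singleton hC hint h₀) fun ε hε => ?_
    have hsum := tendsto_finsetSum (Finset.univ : Finset I) fun h _ =>
      tendsto_likelihoodRatio_sub hC hint h h₀ hε
    rw [Finset.sum_const_zero] at hsum
    refine squeeze_zero (fun _ => measureReal_nonneg) (fun n => ?_) hsum
    refine le_trans (measureReal_mono ?_ (measure_ne_top _ _))
      (measureReal_biUnion_finset_le _ _)
    -- A sup norm of at least `ε` forces some coordinate to be at least `ε`, so a union bound over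
    -- `I` reduces to single ratios.
    intro x hx
    by_contra hcon
    simp only [Set.mem_iUnion, Finset.mem_univ, Set.mem_ofPred_eq, exists_prop, true_and,
      not_exists, not_le] at hcon
    exact absurd ((pi_norm_lt_iff hε).2 hcon) (not_lt.2 hx)
  refine hmain.congr (fun _ => EventuallyEq.rfl) ?_
  have hall : ∀ᵐ z ∂(limitLaw G h₀), ∀ h : I,
      likelihoodRatio (limitLaw G h) (limitLaw G h₀) z = limitRatio G h h₀ z :=
    ae_all_iff.2 fun h => likelihoodRatio_limitLaw G h h₀
  filter_upwards [hall] with z hz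
  exact funext fun h => (hz h).symm

end INAR

end

/-! ### The limit theorem -/

theorem theorem3p1 (G : Measure ℕ) [IsProbabilityMeasure G] (hG : INAR.Admissible G) :
    -- convergence of the experiments in Le Cam's sense
    INAR.ExperimentsConverge (INAR.localLaw G) (INAR.limitLaw G) ∧
    -- the limit of the likelihood ratio for `h₀ > 0`, and its explicit form
    (∀ h h₀ : ℝ≥0, 0 < h₀ →
      TendstoInDistribution
        (fun n => INAR.likelihoodRatio (INAR.localLaw G n h) (INAR.localLaw G n h₀)) atTop
        (fun z : ℕ =>
          Real.exp (-(((h : ℝ) - h₀) * G.real {0} * INAR.mean G / 2)) * ((h : ℝ) / h₀) ^ z)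
        (fun n => INAR.localLaw G n h₀) (INAR.limitLaw G h₀) ∧
      INAR.likelihoodRatio (INAR.limitLaw G h) (INAR.limitLaw G h₀) =ᵐ[INAR.limitLaw G h₀]
        fun z : ℕ =>
          Real.exp (-(((h : ℝ) - h₀) * G.real {0} * INAR.mean G / 2)) * ((h : ℝ) / h₀) ^ z) ∧
    -- the limit of the likelihood ratio for `h₀ = 0`, and its explicit form
    (∀ h : ℝ≥0,
      TendstoInDistribution
        (fun n => INAR.likelihoodRatio (INAR.localLaw G n h) (INAR.localLaw G n 0)) atTop
        (fun z : ℕ =>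
          Real.exp (-((h : ℝ) * G.real {0} * INAR.mean G / 2)) * if z = 0 then 1 else 0)
        (fun n => INAR.localLaw G n 0) (INAR.limitLaw G 0) ∧
      INAR.likelihoodRatio (INAR.limitLaw G h) (INAR.limitLaw G 0) =ᵐ[INAR.limitLaw G 0]
        fun z : ℕ =>
          Real.exp (-((h : ℝ) * G.real {0} * INAR.mean G / 2)) * if z = 0 then 1 else 0) := by
  obtain ⟨C, hC⟩ := hG.exists_almostDecreasing
  have hint := hG.integrable
  have hzero : ∀ h : ℝ≥0, (fun z : ℕ =>
      Real.exp (-((h : ℝ) * G.real {0} * INAR.mean G / 2)) * if z = 0 then (1 : ℝ) else 0) =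
      INAR.limitRatio G h 0 := fun h => by
    funext z
    simp [INAR.limitRatio, zero_pow_eq]
  refine ⟨INAR.experimentsConverge_localLaw hC hint, fun h h₀ _ =>
    ⟨INAR.tendstoInDistribution_likelihoodRatio hC hint h h₀,
      INAR.likelihoodRatio_limitLaw G h h₀⟩, fun h => ?_⟩
  rw [hzero]
  exact ⟨INAR.tendstoInDistribution_likelihoodRatio hC hint h 0,
    INAR.likelihoodRatio_limitLaw G h 0⟩
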